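/- Let $p,q\ge 1$ and put $(w,w')_{p,q}=\sum_{j=1}^p x_jx_j'-\sum_{j=1}^q y_jy_j'$ for $w=(x,y)$, $w'=(x',y')$ in $\mathbb R^{p+q}=\mathbb R^p\oplus\mathbb R^q$. Let $\mathrm O(p,q)\subseteq \mathrm{GL}(p+q,\mathbb R)$ be the isometry group of this form, and let $$X^0=\{w\in\mathbb R^{p+q}\setminus\{0\} : (w,w)_{p,q}=0\}$$ be the light cone. Give the space $C^\infty(X^0)$ of smooth complex-valued functions on $X^0$ its usual topology (uniform convergence on compact sets of all derivatives in local coordinates) and the action $(\rho(g)f)(w)=f(g^{-1}w)$ of $\mathrm O(p,q)$. For $a\in\mathbb C$ let $$S^{a\pm}(X^0)=\{f\in C^\infty(X^0) : f(tw)=t^af(w)\ \text{and}\ f(-w)=\pm f(w)\ \text{for all } w\in X^0,\ t>0\},$$ which are $\mathrm O(p,q)$-invariant subspaces. **Proposition 2.4.** If $a\in\mathbb C$ is not an integer, then each of $S^{a+}(X^0)$ and $S^{a-}(X^0)$ is an irreducible $\mathrm O(p,q)$-module; that is, it is nonzero and its only closed $\mathrm O(p,q)$-invariant subspaces are $\{0\}$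 and the whole space. -/

import Mathlib

open Set Topology
open scoped ContDiff UniformConvergence

namespace LightCone

/-- `ℝ^{p+q} = ℝ^p ⊕ ℝ^q`, with points written `w = (x, y)`. -/
abbrev Ambient (p q : ℕ) : Type :=
  EuclideanSpace ℝ (Fin p) × EuclideanSpace ℝ (Fin q)

/-- The indefinite inner product `(w, w')_{p,q} = ∑ x_j x'_j - ∑ y_j y'_j`. -/
def form {p q : ℕ} (w w' : Ambient p q) : ℝ :=
  (∑ j, w.1 j * w'.1 j) - ∑ j, w.2 j * w'.2 j

/-- `O(p,q)`: the group of linear automorphisms of `ℝ^{p+q}` that preserve the form. -/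
def indefiniteOrthogonalGroup (p q : ℕ) : Subgroup (Ambient p q ≃ₗ[ℝ] Ambient p q) where
  carrier := {g | ∀ w w', form (g w) (g w') = form w w'}
  mul_mem' := by
    intro g h hg hh w w'
    rw [LinearEquiv.mul_apply, LinearEquiv.mul_apply, hg, hh]
  one_mem' := fun _ _ => rfl
  inv_mem' := by
    intro g hg w w'
    have h := hg (g⁻¹ w) (g⁻¹ w')
    rw [← LinearEquiv.mul_apply, ← LinearEquiv.mul_apply, mul_inv_cancel] at h
    exact h.symm

/-- The light cone `X⁰ = {w ≠ 0 | (w, w)_{p,q} = 0}` (the origin is excluded). -/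
def cone (p q : ℕ) : Set (Ambient p q) := {w | w ≠ 0 ∧ form w w = 0}

theorem map_mem_cone {p q : ℕ} (g : indefiniteOrthogonalGroup p q) {w : Ambient p q}
    (hw : w ∈ cone p q) : g.1 w ∈ cone p q :=
  ⟨fun h => hw.1 ((LinearEquiv.map_eq_zero_iff g.1).1 h), by rw [g.2 w w]; exact hw.2⟩

theorem smul_mem_cone {p q : ℕ} {t : ℝ} (ht : t ≠ 0) {w : Ambient p q}
    (hw : w ∈ cone p q) : t • w ∈ cone p q := by
  refine ⟨smul_ne_zero ht hw.1, ?_⟩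
  have h : form (t • w) (t • w) = t * t * form w w := by
    simp only [form, Prod.smul_fst, Prod.smul_snd, PiLp.smul_apply, smul_eq_mul, mul_sub,
      Finset.mul_sum]
    congr 1 <;> exact Finset.sum_congr rfl fun _ _ => by ring
  rw [h, hw.2, mul_zero]

/-- The action of `O(p,q)` on the light cone. -/
instance (p q : ℕ) : MulAction (indefiniteOrthogonalGroup p q) (cone p q) where
  smul g w := ⟨g.1 w.1, map_mem_cone g w.2⟩
  one_smul _ := rfl
  mul_smul _ _ _ := rfl

/-- The dilation `w ↦ t w` of the light cone, for a nonzero real `t`. -/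
def dilate {p q : ℕ} (t : ℝ) (ht : t ≠ 0) (w : cone p q) : cone p q :=
  ⟨t • w.1, smul_mem_cone ht w.2⟩

/-! ### Smooth functions on the light cone -/

/-- A function on the light cone (an embedded submanifold of `ℝ^{p+q}`) is smooth if near each
point of the cone it is the restriction of a smooth function on an open subset of `ℝ^{p+q}`. -/
def IsSmooth {p q : ℕ} (f : cone p q → ℂ) : Prop :=
  ∀ w : cone p q, ∃ (U : Set (Ambient p q)) (F : Ambient p q → ℂ),
    IsOpen U ∧ w.1 ∈ U ∧ ContDiffOn ℝ ∞ F U ∧ ∀ v : cone p q, v.1 ∈ U → F v.1 = f v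

theorem IsSmooth.comp_smul {p q : ℕ} {f : cone p q → ℂ} (hf : IsSmooth f)
    (g : indefiniteOrthogonalGroup p q) : IsSmooth fun w => f (g • w) := by
  intro w
  obtain ⟨U, F, hU, hw, hF, hFf⟩ := hf (g • w)
  have hg : ContDiff ℝ ∞ (g.1 : Ambient p q → Ambient p q) :=
    g.1.toLinearMap.toContinuousLinearMap.contDiff
  exact ⟨(g.1 : Ambient p q → Ambient p q) ⁻¹' U, F ∘ g.1, hU.preimage hg.continuous, hw,
    hF.comp hg.contDiffOn fun _ h => h, fun v hv => hFf (g • v) hv⟩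

/-- The smooth functions, as a subspace of all complex functions on the light cone. -/
def smoothSubmodule (p q : ℕ) : Submodule ℂ (cone p q → ℂ) where
  carrier := {f | IsSmooth f}
  zero_mem' := fun _ => ⟨univ, fun _ => 0, isOpen_univ, mem_univ _, contDiffOn_const,
    fun _ _ => rfl⟩
  add_mem' := by
    intro f₁ f₂ h₁ h₂ w
    obtain ⟨U₁, F₁, hU₁, hw₁, hF₁, e₁⟩ := h₁ w
    obtain ⟨U₂, F₂, hU₂, hw₂, hF₂, e₂⟩ := h₂ w
    refine ⟨U₁ ∩ U₂, fun v => F₁ v + F₂ v, hU₁.inter hU₂, ⟨hw₁, hw₂⟩,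
      (hF₁.mono inter_subset_left).add (hF₂.mono inter_subset_right), fun v hv => ?_⟩
    simp only [Pi.add_apply, e₁ v hv.1, e₂ v hv.2]
  smul_mem' := by
    intro c f h w
    obtain ⟨U, F, hU, hw, hF, e⟩ := h w
    refine ⟨U, fun v => c • F v, hU, hw, hF.const_smul c, fun v hv => ?_⟩
    simp only [Pi.smul_apply, e v hv]

/-- The space `C^∞(X⁰)`. It is a type of its own, so that it carries the smooth topology below
and not the topology of pointwise convergence of a subspace of `X⁰ → ℂ`. -/
def Smooth (p q : ℕ) : Type := smoothSubmodule p q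

noncomputable instance (p q : ℕ) : AddCommGroup (Smooth p q) :=
  inferInstanceAs (AddCommGroup (smoothSubmodule p q))

noncomputable instance (p q : ℕ) : Module ℂ (Smooth p q) :=
  inferInstanceAs (Module ℂ (smoothSubmodule p q))

instance (p q : ℕ) : CoeFun (Smooth p q) fun _ => cone p q → ℂ := ⟨fun f => f.1⟩

/-- A smooth map from an open subset `domain` of some `ℝ^d` to the light cone
(the values of `toFun` outside `domain` play no role). -/
structure Plot (p q : ℕ) where
  dim : ℕ
  domain : Set (EuclideanSpace ℝ (Fin dim))
  isOpen_domain : IsOpen domain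
  toFun : EuclideanSpace ℝ (Fin dim) → cone p q
  contDiffOn : ContDiffOn ℝ ∞ (fun u => (toFun u).1) domain

/-- The usual Fréchet topology of `C^∞(X⁰)`, that of uniform convergence on compact sets of all
derivatives in local coordinates: the coarsest topology such that for every smooth map
`φ : V → X⁰` with `V` open in some `ℝ^d` (in particular for every local parametrization) and
for every order `k` the map `f ↦ D^k (f ∘ φ)` is continuous for the topology of uniform
convergence on the compact subsets of `V`. -/
noncomputable instance (p q : ℕ) : TopologicalSpace (Smooth p q) :=
  ⨅ (φ : Plot p q) (k : ℕ), TopologicalSpace.induced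
    (fun f : Smooth p q => UniformOnFun.ofFun {K | IsCompact K ∧ K ⊆ φ.domain}
      (iteratedFDeriv ℝ k fun u => f (φ.toFun u)))
    inferInstance

/-- The representation of `O(p,q)` on `C^∞(X⁰)`, `(ρ(g) f)(w) = f(g⁻¹ w)`. -/
noncomputable def rho (p q : ℕ) :
    Representation ℂ (indefiniteOrthogonalGroup p q) (Smooth p q) where
  toFun g :=
    { toFun := fun f => ⟨fun w => f (g⁻¹ • w), IsSmooth.comp_smul f.2 g⁻¹⟩
      map_add' := fun _ _ => rfl
      map_smul' := fun _ _ => rfl }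
  map_one' := by
    refine LinearMap.ext fun f => Subtype.ext (funext fun w => ?_)
    change f ((1 : indefiniteOrthogonalGroup p q)⁻¹ • w) = f w
    rw [inv_one, one_smul]
  map_mul' g h := by
    refine LinearMap.ext fun f => Subtype.ext (funext fun w => ?_)
    change f ((g * h)⁻¹ • w) = f (h⁻¹ • (g⁻¹ • w))
    rw [mul_inv_rev, mul_smul]

/-! ### Homogeneous functions -/

/-- `S^a(X⁰)`: smooth `f` with `f (t w) = t ^ a f w` for all real `t > 0`. -/
noncomputable def homogeneous (p q : ℕ) (a : ℂ) : Submodule ℂ (Smooth p q) where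
  carrier := {f | ∀ (t : ℝ) (ht : 0 < t) (w : cone p q),
    f (dilate t ht.ne' w) = (t : ℂ) ^ a * f w}
  zero_mem' := fun t _ _ => (mul_zero ((t : ℂ) ^ a)).symm
  add_mem' := by
    intro f₁ f₂ h₁ h₂ t ht w
    change f₁ _ + f₂ _ = (t : ℂ) ^ a * (f₁ w + f₂ w)
    rw [h₁ t ht w, h₂ t ht w, mul_add]
  smul_mem' := by
    intro c f h t ht w
    change c * f _ = (t : ℂ) ^ a * (c * f w)
    rw [h t ht w, mul_left_comm]

/-- The `f` in `C^∞(X⁰)` with `f (-w) = ε f w`, where `ε` is `1` or `-1`. -/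
noncomputable def parity (p q : ℕ) (ε : ℤˣ) : Submodule ℂ (Smooth p q) where
  carrier := {f | ∀ w : cone p q,
    f (dilate (-1) (neg_ne_zero.2 one_ne_zero) w) = ((ε : ℤ) : ℂ) * f w}
  zero_mem' := fun _ => (mul_zero (((ε : ℤ) : ℂ))).symm
  add_mem' := by
    intro f₁ f₂ h₁ h₂ w
    change f₁ _ + f₂ _ = ((ε : ℤ) : ℂ) * (f₁ w + f₂ w)
    rw [h₁ w, h₂ w, mul_add]
  smul_mem' := by
    intro c f h w
    change c * f _ = ((ε : ℤ) : ℂ) * (c * f w)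
    rw [h w, mul_left_comm]

theorem smul_dilate {p q : ℕ} (g : indefiniteOrthogonalGroup p q) (t : ℝ) (ht : t ≠ 0)
    (w : cone p q) : g • dilate t ht w = dilate t ht (g • w) :=
  Subtype.ext (map_smul g.1 t w.1)

/-- `S^{a+}(X⁰)` (for `ε = 1`) and `S^{a-}(X⁰)` (for `ε = -1`), as subrepresentations of
`C^∞(X⁰)`. -/
noncomputable def homogeneousParity (p q : ℕ) (a : ℂ) (ε : ℤˣ) : Subrepresentation (rho p q) where
  toSubmodule := homogeneous p q a ⊓ parity p q ε
  apply_mem_toSubmodule := by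
    rintro g f ⟨h₁, h₂⟩
    refine ⟨fun t ht w => ?_, fun w => ?_⟩
    · change f (g⁻¹ • dilate t _ w) = (t : ℂ) ^ a * f (g⁻¹ • w)
      rw [smul_dilate, h₁ t ht]
    · change f (g⁻¹ • dilate (-1) _ w) = ((ε : ℤ) : ℂ) * f (g⁻¹ • w)
      rw [smul_dilate, h₂]

/-- Irreducibility of a representation on a topological vector space: the space is nonzero, and
its only closed invariant subspaces are `0` and the whole space. -/
def IsTopologicallyIrreducible {G V : Type*} [Group G] [AddCommGroup V] [Module ℂ V]
    [TopologicalSpace V] (ρ : Representation ℂ G V) : Prop :=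
  Nontrivial V ∧ ∀ W : Subrepresentation ρ, IsClosed (W.toSubmodule : Set V) →
    W.toSubmodule = ⊥ ∨ W.toSubmodule = ⊤

end LightCone

/-! Let `K = O(p) × O(q)`, which acts transitively on the product of unit spheres `|x| = |y| = 1`, a
section of the cone modulo positive dilations. A polynomial `P` gives the function `|x|^a P(w/|x|)`
of degree `a` (`polyMap`). The argument reduces to these functions and shows that a closed invariant
subspace `W` is stable under multiplication by even polynomials.

Multiplication by `x_i y_j`. Since `W` is closed it is stable under the Lie algebra
(`generator_mem`), hence under rotations and boosts. Let `L` be the sum of the Laplace operators of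
the two spheres, a combination of squares of rotations. On the product of spheres the commutator
`[L, x_i y_j]` is twice the boost minus `(2a+p+q-2) x_i y_j` (`two_smul_boost`). If `P` in `W` has
eigenvalue `e` under `L`, then `T = x_i y_j P` satisfies `(L - e + 2a+p+q-2) T ∈ W`. In bidegree
`(m,n)` the eigenvalues of `L` are integers with the parity of `(p+1)m + (q+1)n`
(`bidegree_le_spectral`), and `x_i y_j` shifts this parity by `p+q`. So `e - (2a+p+q-2)` can be an
eigenvalue on `T` only if `2a` is an even integer. As `a` is not an integer, the factor can be
inverted by a polynomial in `L`, and `T ∈ W` (`IsBoostStable.mul_mem_of_factors`). Tracking the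
parity is what allows half-integral `a`; the parity is detected by an element of `K`, the `twist`.
The relations `∑ x_i² = ∑ y_j² = 1` then give all products of two variables, hence all even
polynomials (`IsClosedInvariant.even_mul_mem`).

From one polynomial function to all. If `P` in `W` is nonzero and `Q` has the same parity, then
`conj(R) Q` is even for each `K`-translate `R` of `P`, so `|R|² Q ∈ W`. Averaging over `K` turns
`|R|²` into a positive constant by transitivity, so `Q ∈ W` (`IsClosedInvariant.polyMap_mem`).

Density. Convolving a homogeneous `f` over `K` with powers of a polynomial peaked at the identity
gives polynomial functions that converge to `f` in the smooth topology and lie in every closed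
invariant subspace containing `f` (`exists_tendsto_polyMap`). So a nonzero `W` contains a nonzero
polynomial function, then all those of its parity, then their closure. -/

namespace LightCone

open MeasureTheory Filter

variable {p q : ℕ}

/-! ### Jets along plots and convergence in `C^∞(X⁰)` -/

/-- The `k`-th derivative of `f` along the plot `φ`. -/
noncomputable def jet (φ : Plot p q) (k : ℕ) (f : Smooth p q) (u : EuclideanSpace ℝ (Fin φ.dim)) :
    EuclideanSpace ℝ (Fin φ.dim) [×k]→L[ℝ] ℂ :=
  iteratedFDeriv ℝ k (fun u => f (φ.toFun u)) u

theorem tendsto_smooth_iff {ι : Type*} {l : Filter ι} {G : ι → Smooth p q} {g : Smooth p q} :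
    Tendsto G l (𝓝 g) ↔ ∀ (φ : Plot p q) (k : ℕ) (K : Set (EuclideanSpace ℝ (Fin φ.dim))),
      IsCompact K → K ⊆ φ.domain →
        TendstoUniformlyOn (fun i => jet φ k (G i)) (jet φ k g) l K := by
  simp only [nhds_iInf, nhds_induced, tendsto_iInf, tendsto_comap_iff,
    UniformOnFun.tendsto_iff_tendstoUniformlyOn]
  exact ⟨fun h φ k K h₁ h₂ => h φ k K ⟨h₁, h₂⟩, fun h φ k K hK => h φ k K hK.1 hK.2⟩

theorem contDiffOn_comp_plot (φ : Plot p q) (f : Smooth p q) :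
    ContDiffOn ℝ ∞ (fun u => f (φ.toFun u)) φ.domain := by
  intro u hu
  obtain ⟨U, F, hU, hw, hF, h⟩ := f.2 (φ.toFun u)
  have h₁ : ContDiffWithinAt ℝ ∞ (fun u => F (φ.toFun u).1) φ.domain u :=
    ContDiffAt.comp_contDiffWithinAt u ((hF _ hw).contDiffAt (hU.mem_nhds hw)) (φ.contDiffOn u hu)
  refine h₁.congr_of_eventuallyEq ?_ (h _ hw).symm
  filter_upwards [(φ.contDiffOn.continuousOn u hu) (hU.mem_nhds hw)] with v hv
  exact (h _ hv).symm

theorem hasFTaylorSeriesUpToOn_jet (φ : Plot p q) (f : Smooth p q) :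
    HasFTaylorSeriesUpToOn ∞ (fun u => f (φ.toFun u)) (fun u k => jet φ k f u) φ.domain := by
  have h := (contDiffOn_comp_plot φ f).ftaylorSeriesWithin φ.isOpen_domain.uniqueDiffOn
  refine h.congr_series fun k _ u hu => ?_
  exact iteratedFDerivWithin_of_isOpen k φ.isOpen_domain hu

theorem continuousOn_jet (φ : Plot p q) (k : ℕ) (f : Smooth p q) :
    ContinuousOn (jet φ k f) φ.domain :=
  (hasFTaylorSeriesUpToOn_jet φ f).cont k (by exact_mod_cast le_top)

theorem jet_add (φ : Plot p q) (k : ℕ) (f g : Smooth p q) {u} (hu : u ∈ φ.domain) :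
    jet φ k (f + g) u = jet φ k f u + jet φ k g u := by
  have h (f : Smooth p q) := ((contDiffOn_comp_plot φ f).contDiffAt
    (φ.isOpen_domain.mem_nhds hu)).of_le (m := k) (by exact_mod_cast le_top)
  exact iteratedFDeriv_add_apply (h f) (h g)

theorem jet_smul (φ : Plot p q) (k : ℕ) (c : ℂ) (f : Smooth p q) {u} (hu : u ∈ φ.domain) :
    jet φ k (c • f) u = c • jet φ k f u := by
  have h (f : Smooth p q) := ((contDiffOn_comp_plot φ f).contDiffAt
    (φ.isOpen_domain.mem_nhds hu)).of_le (m := k) (by exact_mod_cast le_top)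
  exact iteratedFDeriv_const_smul_apply (h f)

/-- The space of `k`-linear maps `ℝ^d × ⋯ × ℝ^d → ℂ`, with the operator norm. -/
def JetSpace (d k : ℕ) : Type := EuclideanSpace ℝ (Fin d) [×k]→L[ℝ] ℂ

noncomputable instance (d k : ℕ) : NormedAddCommGroup (JetSpace d k) :=
  inferInstanceAs (NormedAddCommGroup (EuclideanSpace ℝ (Fin d) [×k]→L[ℝ] ℂ))

noncomputable instance (d k : ℕ) : NormedSpace ℝ (JetSpace d k) :=
  inferInstanceAs (NormedSpace ℝ (EuclideanSpace ℝ (Fin d) [×k]→L[ℝ] ℂ))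

noncomputable instance (d k : ℕ) : NormedSpace ℂ (JetSpace d k) :=
  inferInstanceAs (NormedSpace ℂ (EuclideanSpace ℝ (Fin d) [×k]→L[ℝ] ℂ))

instance (d k : ℕ) : CompleteSpace (JetSpace d k) :=
  inferInstanceAs (CompleteSpace (EuclideanSpace ℝ (Fin d) [×k]→L[ℝ] ℂ))

instance (d k : ℕ) : IsScalarTower ℝ ℂ (JetSpace d k) :=
  inferInstanceAs (IsScalarTower ℝ ℂ (EuclideanSpace ℝ (Fin d) [×k]→L[ℝ] ℂ))

/-- The jet of `f` restricted to a compact subset of the domain of the plot. -/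
noncomputable def jetOn (φ : Plot p q) (k : ℕ) {K : Set (EuclideanSpace ℝ (Fin φ.dim))}
    (hK : K ⊆ φ.domain) : Smooth p q →ₗ[ℂ] C(K, JetSpace φ.dim k) where
  toFun f := ⟨fun u => jet φ k f u, ((continuousOn_jet φ k f).mono hK).domRestrict⟩
  map_add' f g := ContinuousMap.ext fun u => jet_add φ k f g (hK u.2)
  map_smul' c f := ContinuousMap.ext fun u => jet_smul φ k c f (hK u.2)

/-- Reduces convergence in the Fréchet topology to convergence in the Banach spaces `C(K, JetSpace d
k)`, where vector-valued integration is available. -/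
theorem tendsto_smooth_of_jetOn {ι : Type*} {l : Filter ι} {G : ι → Smooth p q} {g : Smooth p q}
    (h : ∀ (φ : Plot p q) (k : ℕ) (K : Set (EuclideanSpace ℝ (Fin φ.dim))) (_ : IsCompact K)
      (hK : K ⊆ φ.domain), Tendsto (fun i => jetOn φ k hK (G i)) l (𝓝 (jetOn φ k hK g))) :
    Tendsto G l (𝓝 g) := by
  refine tendsto_smooth_iff.2 fun φ k K hc hK => ?_
  have := isCompact_iff_compactSpace.1 hc
  rw [tendstoUniformlyOn_iff_tendstoUniformly_comp_coe]
  exact ContinuousMap.tendsto_iff_tendstoUniformly.1 (h φ k K hc hK)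

theorem continuous_eval (w : cone p q) : Continuous fun f : Smooth p q => f w := by
  refine continuous_iff_continuousAt.2 fun f => ?_
  -- Evaluation at `w` is the jet of order zero along the constant plot of dimension zero.
  let φ : Plot p q := ⟨0, univ, isOpen_univ, fun _ => w, contDiffOn_const⟩
  have h := (tendsto_smooth_iff.1 (tendsto_id (x := 𝓝 f))) φ 0 {0} isCompact_singleton
    (subset_univ _)
  have h' := h.tendsto_at (mem_singleton _)
  have h'' := ((ContinuousMultilinearMap.apply ℝ
    (fun _ : Fin 0 => EuclideanSpace ℝ (Fin φ.dim)) ℂ 0).continuous.tendsto _).comp h'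
  simpa [Function.comp_def, jet, φ, ContinuousAt] using h''

/-! ### Families of smooth functions -/

/-- A family of smooth functions all of whose jets depend jointly continuously on the parameter
and the point. -/
def JetContinuous {S : Type*} [TopologicalSpace S] (G : S → Smooth p q) : Prop :=
  ∀ (φ : Plot p q) (k : ℕ),
    ContinuousOn (fun z : S × EuclideanSpace ℝ (Fin φ.dim) => jet φ k (G z.1) z.2)
      (univ ×ˢ φ.domain)

theorem JetContinuous.continuous_jetOn {S : Type*} [TopologicalSpace S] {G : S → Smooth p q}
    (hG : JetContinuous G) (φ : Plot p q) (k : ℕ) {K : Set (EuclideanSpace ℝ (Fin φ.dim))}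
    (hK : K ⊆ φ.domain) : Continuous fun s => jetOn φ k hK (G s) := by
  refine ContinuousMap.continuous_of_continuous_uncurry _ ?_
  exact (hG φ k).comp_continuous (f := fun z : S × K => (z.1, (z.2 : EuclideanSpace ℝ (Fin φ.dim))))
    (by fun_prop) fun z => ⟨mem_univ _, hK z.2.2⟩

theorem JetContinuous.continuous {S : Type*} [TopologicalSpace S] {G : S → Smooth p q}
    (hG : JetContinuous G) : Continuous G :=
  continuous_iff_continuousAt.2 fun s => tendsto_smooth_of_jetOn fun φ k _ _ hK =>
    (hG.continuous_jetOn φ k hK).tendsto s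

theorem JetContinuous.smul {S : Type*} [TopologicalSpace S] {G : S → Smooth p q}
    (hG : JetContinuous G) {c : S → ℂ} (hc : Continuous c) : JetContinuous fun s => c s • G s :=
  fun φ k => ((hc.comp continuous_fst).continuousOn.smul (hG φ k)).congr
    fun _ hz => jet_smul φ k _ _ hz.2

/-- Freezing the parameter is composition with an affine inclusion, so the partial derivative is the
full derivative of `H` precomposed with `inr`; the latter is jointly continuous. -/
theorem continuousOn_iteratedFDeriv_partial {A E F : Type*} [NormedAddCommGroup A]
    [NormedSpace ℝ A] [NormedAddCommGroup E] [NormedSpace ℝ E] [NormedAddCommGroup F]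
    [NormedSpace ℝ F] {H : A × E → F} {O : Set (A × E)} (hO : IsOpen O)
    (hH : ContDiffOn ℝ ∞ H O) (k : ℕ) :
    ContinuousOn (fun z : A × E => iteratedFDeriv ℝ k (fun u => H (z.1, u)) z.2) O := by
  have key : ∀ z ∈ O, iteratedFDeriv ℝ k (fun u => H (z.1, u)) z.2 =
      (iteratedFDeriv ℝ k H z).compContinuousLinearMap
        fun _ => ContinuousLinearMap.inr ℝ A E := by
    intro z hz
    let s : Set (A × E) := (fun v => (z.1, 0) + v) ⁻¹' O
    let ι := ContinuousLinearMap.inr ℝ A E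
    have hs : IsOpen s := hO.preimage (by fun_prop)
    have hs' : IsOpen (ι ⁻¹' s) := hs.preimage ι.continuous
    have hz' : ι z.2 ∈ s := by simpa [s, ι] using hz
    have h₁ : ContDiffOn ℝ ∞ (fun v : A × E => H ((z.1, 0) + v)) s :=
      hH.comp (contDiffOn_const.add contDiffOn_id) fun v hv => hv
    have h₂ := ι.iteratedFDerivWithin_comp_right h₁ hs.uniqueDiffOn hs'.uniqueDiffOn hz'
      (i := k) (by exact_mod_cast le_top)
    rw [iteratedFDerivWithin_of_isOpen k hs' hz', iteratedFDerivWithin_of_isOpen k hs hz',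
      iteratedFDeriv_comp_add_left] at h₂
    have h₃ : (z.1, 0) + ι z.2 = z := by simp [ι]
    rw [h₃] at h₂
    rw [← h₂]
    congr 1
    ext u
    simp [ι]
  refine ContinuousOn.congr ?_ key
  have h₁ : ContinuousOn (iteratedFDeriv ℝ k H) O :=
    ((hH.continuousOn_iteratedFDerivWithin (m := k) (by exact_mod_cast le_top)
      hO.uniqueDiffOn)).congr fun z hz => (iteratedFDerivWithin_of_isOpen k hO hz).symm
  exact (ContinuousMultilinearMap.compContinuousLinearMapL (𝕜 := ℝ) (F := F)
    (fun _ : Fin k => ContinuousLinearMap.inr ℝ A E)).continuous.comp_continuousOn h₁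

/-- The parameter enters only through a continuous map `ι` into a normed space, so `S` may be a
compact group that carries no smooth structure here. -/
theorem jetContinuous_of_contDiffOn {A S : Type*} [NormedAddCommGroup A] [NormedSpace ℝ A]
    [TopologicalSpace S] {G : S → Smooth p q} {ι : S → A} (hι : Continuous ι)
    {F : A × Ambient p q → ℂ} {O : Set (A × Ambient p q)} (hO : IsOpen O)
    (hF : ContDiffOn ℝ ∞ F O) (hmem : ∀ s (w : cone p q), (ι s, w.1) ∈ O)
    (hG : ∀ s (w : cone p q), G s w = F (ι s, w.1)) : JetContinuous G := by
  intro φ k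
  let j : A × EuclideanSpace ℝ (Fin φ.dim) → A × Ambient p q := fun z => (z.1, (φ.toFun z.2).1)
  have hj : ContDiffOn ℝ ∞ j (univ ×ˢ φ.domain) :=
    contDiffOn_fst.prodMk (φ.contDiffOn.comp contDiffOn_snd fun z hz => hz.2)
  have hO' : IsOpen ((univ ×ˢ φ.domain) ∩ j ⁻¹' O) :=
    hj.continuousOn.isOpen_inter_preimage (isOpen_univ.prod φ.isOpen_domain) hO
  have h := continuousOn_iteratedFDeriv_partial hO'
    (hF.comp (hj.mono inter_subset_left) inter_subset_right) k
  have h' := h.comp (s := univ ×ˢ φ.domain)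
    (f := fun z : S × EuclideanSpace ℝ (Fin φ.dim) => (ι z.1, z.2)) (by fun_prop)
    fun z hz => ⟨⟨mem_univ _, hz.2⟩, hmem _ _⟩
  refine h'.congr fun z _ => ?_
  simp only [jet, Function.comp_apply, hG, j]

end LightCone

namespace LightCone

open MeasureTheory Filter

variable {p q : ℕ}

/-! ### Integrals of families of smooth functions -/

theorem integral_curryLeft {E F S : Type*} {n : ℕ} [NormedAddCommGroup E] [NormedSpace ℝ E]
    [NormedAddCommGroup F] [NormedSpace ℝ F] [MeasurableSpace S] (μ : Measure S)
    (f : S → E [×(n + 1)]→L[ℝ] F) :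
    ∫ s, (f s).curryLeft ∂μ = (∫ s, f s ∂μ).curryLeft :=
  ContinuousLinearEquiv.integral_comp_comm (𝕜 := ℝ) (μ := μ) (E := E [×(n + 1)]→L[ℝ] F)
    (F := E →L[ℝ] E [×n]→L[ℝ] F)
    (continuousMultilinearCurryLeftEquiv ℝ (fun _ : Fin (n + 1) => E) F).toContinuousLinearEquiv f

section Integral

variable {S : Type*} [TopologicalSpace S] [SecondCountableTopology S] [MeasurableSpace S]
  [OpensMeasurableSpace S]

/-- Differentiation under the integral sign, one order at a time: jets of order `k + 1` are bounded
on the product of `Z` and a small closed ball. The integrated jets therefore form a Taylor series of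
`g`, and Taylor series on an open set are unique. -/
theorem JetContinuous.jet_integral {μ : Measure S} [IsFiniteMeasureOnCompacts μ]
    {G : S → Smooth p q} (hG : JetContinuous G) {Z : Set S} (hZ : IsCompact Z)
    (hZm : MeasurableSet Z) {g : Smooth p q} (hg : ∀ w, g w = ∫ s in Z, G s w ∂μ)
    (φ : Plot p q) (k : ℕ) {u} (hu : u ∈ φ.domain) :
    jet φ k g u = ∫ s in Z, jet φ k (G s) u ∂μ := by
  have hcont (k : ℕ) {u} (hu : u ∈ φ.domain) : Continuous fun s => jet φ k (G s) u :=
    (hG φ k).comp_continuous (f := fun s : S => (s, u)) (by fun_prop) fun s => ⟨mem_univ _, hu⟩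
  have hfin : IsFiniteMeasure (μ.restrict Z) := ⟨by simpa using hZ.measure_lt_top⟩
  have hbound (k : ℕ) {K : Set (EuclideanSpace ℝ (Fin φ.dim))} (hK : IsCompact K)
      (hKd : K ⊆ φ.domain) : ∃ C, ∀ s ∈ Z, ∀ v ∈ K, ‖jet φ k (G s) v‖ ≤ C := by
    obtain ⟨C, hC⟩ := (hZ.prod hK).exists_bound_of_continuousOn
      ((hG φ k).mono (prod_mono (subset_univ _) hKd))
    exact ⟨C, fun s hs v hv => hC (s, v) ⟨hs, hv⟩⟩
  have hint (k : ℕ) {u} (hu : u ∈ φ.domain) :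
      Integrable (fun s => jet φ k (G s) u) (μ.restrict Z) := by
    obtain ⟨C, hC⟩ := hbound k (isCompact_singleton (x := u)) (singleton_subset_iff.2 hu)
    refine Integrable.of_bound (hcont k hu).aestronglyMeasurable C ?_
    filter_upwards [ae_restrict_mem hZm] with s hs using hC s hs u rfl
  have hderiv (k : ℕ) {u} (hu : u ∈ φ.domain) :
      HasFDerivAt (fun v => ∫ s in Z, jet φ k (G s) v ∂μ)
        (∫ s in Z, jet φ (k + 1) (G s) u ∂μ).curryLeft u := by
    obtain ⟨ε, hε, hball⟩ := Metric.nhds_basis_closedBall.mem_iff.1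
      (φ.isOpen_domain.mem_nhds hu)
    obtain ⟨C, hC⟩ := hbound (k + 1) (isCompact_closedBall u ε) hball
    have hk : (k : WithTop ℕ∞) < ∞ := by exact_mod_cast ENat.natCast_lt_top k
    let e := continuousMultilinearCurryLeftEquiv ℝ
      (fun _ : Fin (k + 1) => EuclideanSpace ℝ (Fin φ.dim)) ℂ
    have h := hasFDerivAt_integral_of_dominated_of_fderiv_le (μ := μ.restrict Z)
      (F := fun v s => jet φ k (G s) v) (F' := fun v s => e (jet φ (k + 1) (G s) v))
      (bound := fun _ => C) (x₀ := u) (Metric.closedBall_mem_nhds u hε)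
      (by filter_upwards [φ.isOpen_domain.mem_nhds hu] with v hv
          exact (hcont k hv).aestronglyMeasurable)
      (hint k hu) (e.continuous.comp_aestronglyMeasurable (hcont (k + 1) hu).aestronglyMeasurable)
      (by filter_upwards [ae_restrict_mem hZm] with s hs v hv
          rw [e.norm_map]; exact hC s hs v hv)
      (integrable_const C)
      (by filter_upwards with s v hv
          exact ((hasFTaylorSeriesUpToOn_jet φ (G s)).fderivWithin k hk v (hball hv)).hasFDerivAt
              (φ.isOpen_domain.mem_nhds (hball hv)))
    have h₂ := integral_curryLeft (μ.restrict Z) fun s => jet φ (k + 1) (G s) u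
    rw [← h₂]
    exact h
  have hseries : HasFTaylorSeriesUpToOn ∞ (fun v => g (φ.toFun v))
      (fun v k => ∫ s in Z, jet φ k (G s) v ∂μ) φ.domain := by
    refine ⟨fun v hv => ?_, fun k _ v hv => (hderiv k hv).hasFDerivWithinAt,
      fun k _ v hv => (hderiv k hv).continuousAt.continuousWithinAt⟩
    change (∫ s in Z, jet φ 0 (G s) v ∂μ) 0 = _
    rw [ContinuousMultilinearMap.integral_apply (hint 0 hv), hg]
    simp [jet]
  have h := hseries.eq_iteratedFDerivWithin_of_uniqueDiffOn (m := k)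
    (by exact_mod_cast le_top) φ.isOpen_domain.uniqueDiffOn hu
  rw [iteratedFDerivWithin_of_isOpen k φ.isOpen_domain hu] at h
  exact h.symm

theorem JetContinuous.jetOn_integral {μ : Measure S} [IsFiniteMeasureOnCompacts μ]
    {G : S → Smooth p q} (hG : JetContinuous G) {Z : Set S} (hZ : IsCompact Z)
    (hZm : MeasurableSet Z) {g : Smooth p q} (hg : ∀ w, g w = ∫ s in Z, G s w ∂μ)
    (φ : Plot p q) (k : ℕ) {K : Set (EuclideanSpace ℝ (Fin φ.dim))} [CompactSpace K]
    (hK : K ⊆ φ.domain) :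
    jetOn φ k hK g = ∫ s in Z, jetOn φ k hK (G s) ∂μ := by
  have hfin : IsFiniteMeasure (μ.restrict Z) := ⟨by simpa using hZ.measure_lt_top⟩
  have hcont := hG.continuous_jetOn φ k hK
  have hint : Integrable (fun s => jetOn φ k hK (G s)) (μ.restrict Z) := by
    obtain ⟨C, hC⟩ := hZ.exists_bound_of_continuousOn hcont.continuousOn
    refine Integrable.of_bound hcont.aestronglyMeasurable C ?_
    filter_upwards [ae_restrict_mem hZm] with s hs using hC s hs
  refine ContinuousMap.ext fun u => ?_
  have h := (ContinuousMap.evalCLM ℝ u : C(K, JetSpace φ.dim k) →L[ℝ] _)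
    |>.integral_comp_comm hint
  refine Eq.trans ?_ h
  exact hG.jet_integral hZ hZm hg φ k (hK u.2)

/-- Approximating the identity of `S` by simple functions turns the integral into a limit of finite
combinations of the `G s`. Dominated convergence in each `C(K, JetSpace d k)` makes this a limit in
the smooth topology. -/
theorem JetContinuous.integral_mem [TopologicalSpace.PseudoMetrizableSpace S] [CompactSpace S]
    {μ : Measure S} [IsFiniteMeasure μ]
    {G : S → Smooth p q} (hG : JetContinuous G) {g : Smooth p q}
    (hg : ∀ w, g w = ∫ s, G s w ∂μ) {W : Submodule ℂ (Smooth p q)}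
    (hW : IsClosed (W : Set (Smooth p q))) (hGW : ∀ s, G s ∈ W) : g ∈ W := by
  have hid : StronglyMeasurable (id : S → S) := stronglyMeasurable_id
  let f : ℕ → SimpleFunc S S := hid.approx
  let a : ℕ → Smooth p q := fun n =>
    ∑ s ∈ (f n).range, ((μ.real (f n ⁻¹' {s}) : ℝ) : ℂ) • G s
  have ha (n : ℕ) : a n ∈ W := W.sum_mem fun s _ => W.smul_mem _ (hGW s)
  refine hW.mem_of_tendsto (b := atTop) (f := a) (tendsto_smooth_of_jetOn fun φ k K hc hK => ?_)
    (Eventually.of_forall ha)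
  have := isCompact_iff_compactSpace.1 hc
  have hcont := hG.continuous_jetOn φ k hK
  have hsum (n : ℕ) : jetOn φ k hK (a n) = ∫ s, jetOn φ k hK (G (f n s)) ∂μ := by
    have h₁ : ∀ s, jetOn φ k hK (G (f n s)) =
        ∑ t ∈ (f n).range, (f n ⁻¹' {t}).indicator (fun _ => jetOn φ k hK (G t)) s := by
      intro s
      rw [Finset.sum_eq_single (f n s)]
      · simp
      · intro t _ ht
        rw [indicator_of_notMem]
        exact fun h => ht (mem_singleton_iff.1 h).symm
      · exact fun h => absurd ((f n).mem_range_self s) h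
    simp_rw [h₁]
    rw [integral_finsetSum _ fun t _ => (integrable_const _).indicator ((f n).measurableSet_fiber t),
      map_sum]
    refine Finset.sum_congr rfl fun t _ => ?_
    rw [integral_indicator_const _ ((f n).measurableSet_fiber t), map_smul]
    exact RCLike.real_smul_eq_coe_smul (K := ℂ) _ _ |>.symm
  simp_rw [hsum]
  rw [hG.jetOn_integral isCompact_univ MeasurableSet.univ (μ := μ) (by simpa using hg) φ k hK,
    setIntegral_univ]
  obtain ⟨C, hC⟩ := isCompact_univ.exists_bound_of_continuousOn hcont.continuousOn
  refine tendsto_integral_of_dominated_convergence (fun _ => C) (fun n => ?_)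
    (integrable_const C) (fun n => Eventually.of_forall fun s => hC _ (mem_univ _))
    (Eventually.of_forall fun s => ?_)
  · exact ((f n).map fun s => jetOn φ k hK (G s)).stronglyMeasurable.aestronglyMeasurable
  · exact (hcont.tendsto s).comp (hid.tendsto_approx s)

/-- The probability densities proportional to `c ^ n` concentrate at the unique maximum `s₀` of `c`.
-/
theorem JetContinuous.tendsto_peak [TopologicalSpace.MetrizableSpace S] [BorelSpace S]
    [CompactSpace S] {μ : Measure S} [IsFiniteMeasure μ] [μ.IsOpenPosMeasure] {G : S → Smooth p q}
    (hG : JetContinuous G) {c : S → ℝ} (hc : Continuous c) {s₀ : S} (hlt : ∀ s, s ≠ s₀ → c s < c s₀)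
    (h₀ : ∀ s, 0 ≤ c s) (hpos : 0 < c s₀) {a : ℕ → Smooth p q}
    (ha : ∀ n w, a n w = ∫ s, (c s : ℂ) ^ n * G s w ∂μ) :
    Tendsto (fun n => (((∫ s, c s ^ n ∂μ)⁻¹ : ℝ) : ℂ) • a n) atTop (𝓝 (G s₀)) := by
  refine tendsto_smooth_of_jetOn fun φ k K hK hKd => ?_
  have := isCompact_iff_compactSpace.1 hK
  have hJ (n : ℕ) : JetContinuous fun s => ((c s : ℂ) ^ n) • G s :=
    hG.smul (by fun_prop)
  have h := tendsto_setIntegral_pow_smul_of_unique_maximum_of_isCompact_of_continuousOn (μ := μ)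
    isCompact_univ hc.continuousOn (fun s _ => hlt s) (fun s _ => h₀ s) hpos (x₀ := s₀) (by simp)
    (hG.continuous_jetOn φ k hKd).continuousOn
  refine h.congr fun n => ?_
  rw [map_smul, (hJ n).jetOn_integral isCompact_univ MeasurableSet.univ (μ := μ)
    (fun w => by rw [setIntegral_univ]; exact ha n w) φ k hKd]
  simp only [setIntegral_univ, map_smul]
  refine (RCLike.real_smul_eq_coe_smul (K := ℂ) _ _).trans ?_
  congr 1
  refine integral_congr_ae (Eventually.of_forall fun s => ?_)
  refine (RCLike.real_smul_eq_coe_smul (K := ℂ) _ _).trans ?_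
  simp

end Integral

/-- The difference quotient `s⁻¹ (F s - F 0)` is the mean of `G` over `[0, s]`; its jets converge
uniformly on compact sets by the fundamental theorem of calculus, so pointwise derivatives suffice
as hypothesis. -/
theorem deriv_mem {W : Submodule ℂ (Smooth p q)} (hW : IsClosed (W : Set (Smooth p q)))
    {F G : ℝ → Smooth p q} (hG : JetContinuous G) (hF : ∀ s, F s ∈ W)
    (hFG : ∀ w t, HasDerivAt (fun s => F s w) (G t w) t) : G 0 ∈ W := by
  have hGc (w : cone p q) : Continuous fun t => G t w := (continuous_eval w).comp hG.continuous
  have hint (s : ℝ) (hs : 0 ≤ s) (w : cone p q) :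
      (F s - F 0) w = ∫ t in Icc 0 s, G t w := by
    rw [integral_Icc_eq_integral_Ioc, ← intervalIntegral.integral_of_le hs,
      intervalIntegral.integral_eq_sub_of_hasDerivAt (fun t _ => hFG w t)
        ((hGc w).intervalIntegrable _ _)]
    rfl
  refine hW.mem_of_tendsto (b := 𝓝[>] (0 : ℝ))
    (f := fun s : ℝ => ((s⁻¹ : ℝ) : ℂ) • (F s - F 0))
    (tendsto_smooth_of_jetOn fun φ k K hK hKd => ?_)
    (Eventually.of_forall fun s => W.smul_mem _ (W.sub_mem (hF s) (hF 0)))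
  have := isCompact_iff_compactSpace.1 hK
  have hc := hG.continuous_jetOn φ k hKd
  have h := (intervalIntegral.integral_hasDerivAt_right (hc.intervalIntegrable 0 0)
    hc.aestronglyMeasurable.stronglyMeasurableAtFilter hc.continuousAt)
  have h' := h.tendsto_slope_zero_right
  refine h'.congr' ?_
  filter_upwards [self_mem_nhdsWithin] with s hs
  rw [map_smul, hG.jetOn_integral isCompact_Icc measurableSet_Icc (hint s (le_of_lt hs)) φ k hKd,
    integral_Icc_eq_integral_Ioc, ← intervalIntegral.integral_of_le (le_of_lt hs)]
  refine (RCLike.real_smul_eq_coe_smul (K := ℂ) _ _).trans ?_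
  simp

end LightCone

/-! ### Rotations, Euler and Laplace operators on polynomials -/

namespace LightCone

section Block

open MvPolynomial

variable {ι σ : Type*} (b : ι → σ)

/-- The infinitesimal rotation `x_i ∂_j - x_j ∂_i` in the block of variables `b`. -/
noncomputable def rot (i j : ι) : Derivation ℂ (MvPolynomial σ ℂ) (MvPolynomial σ ℂ) :=
  (X (b i) : MvPolynomial σ ℂ) • pderiv (b j) - (X (b j) : MvPolynomial σ ℂ) • pderiv (b i)

theorem rot_apply (i j : ι) (P : MvPolynomial σ ℂ) :
    rot b i j P = X (b i) * pderiv (b j) P - X (b j) * pderiv (b i) P := by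
  simp [rot]

theorem pderiv_comm (i j : σ) (P : MvPolynomial σ ℂ) :
    pderiv i (pderiv j P) = pderiv j (pderiv i P) := by
  classical
  have h : ⁅(pderiv (R := ℂ) (σ := σ) i), pderiv (R := ℂ) j⁆ = 0 := by
    refine MvPolynomial.derivation_ext fun k => ?_
    simp [Derivation.commutator_apply, pderiv_X, Pi.single_apply, apply_ite (pderiv _)]
  have h' := congrArg (fun D : Derivation ℂ (MvPolynomial σ ℂ) (MvPolynomial σ ℂ) => D P) h
  simpa [Derivation.commutator_apply, sub_eq_zero] using h'

variable {b} in
theorem pderiv_eq_zero_rot {Q : MvPolynomial σ ℂ} (h : ∀ i, pderiv (b i) Q = 0) (i j : ι) :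
    rot b i j Q = 0 := by
  simp [rot_apply, h]

variable {b} in
theorem pderiv_mul_X (hb : Function.Injective b) [DecidableEq ι] (i j : ι) (P : MvPolynomial σ ℂ) :
    pderiv (b j) (X (b i) * P) = X (b i) * pderiv (b j) P + if i = j then P else 0 := by
  classical
  simp [pderiv_X, Pi.single_apply, hb.eq_iff]

variable [Fintype ι]

/-- The squared radius of a block of variables. -/
noncomputable def sqRadius : MvPolynomial σ ℂ := ∑ i, X (b i) * X (b i)

/-- The Euler operator of a block of variables. -/
noncomputable def euler : Derivation ℂ (MvPolynomial σ ℂ) (MvPolynomial σ ℂ) :=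
  ∑ i, (X (b i) : MvPolynomial σ ℂ) • pderiv (b i)

/-- The Laplace operator of a block of variables. -/
noncomputable def laplace : Module.End ℂ (MvPolynomial σ ℂ) :=
  ∑ i, (pderiv (b i)).toLinearMap ∘ₗ (pderiv (b i)).toLinearMap

/-- The Laplace operator of the sphere, as a sum of squares of rotations. -/
noncomputable def casimir : Module.End ℂ (MvPolynomial σ ℂ) :=
  (1 / 2 : ℂ) • ∑ i, ∑ j, (rot b i j).toLinearMap ∘ₗ (rot b i j).toLinearMap

theorem euler_apply (P : MvPolynomial σ ℂ) : euler b P = ∑ i, X (b i) * pderiv (b i) P := by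
  have h := map_sum Derivation.coeFnAddMonoidHom
    (fun i => (X (b i) : MvPolynomial σ ℂ) • pderiv (R := ℂ) (b i)) Finset.univ
  exact (congrFun h P).trans (by simp [Finset.sum_apply])

theorem laplace_apply (P : MvPolynomial σ ℂ) :
    laplace b P = ∑ i, pderiv (b i) (pderiv (b i) P) := by
  simp [laplace]

theorem casimir_apply (P : MvPolynomial σ ℂ) :
    casimir b P = (1 / 2 : ℂ) • ∑ i, ∑ j, rot b i j (rot b i j P) := by
  simp [casimir]

variable {b}

/-- Each rotation is linear over the polynomials that all rotations kill. Used for the squared radii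
and for the variables of the other block. -/
theorem rot_mul_of_rot_eq_zero {Q : MvPolynomial σ ℂ} (hQ : ∀ i j, rot b i j Q = 0)
    (P : MvPolynomial σ ℂ) : casimir b (Q * P) = Q * casimir b P := by
  simp only [casimir_apply, Derivation.leibniz, hQ, mul_zero, add_zero, smul_eq_mul,
    Finset.mul_sum, mul_smul_comm]

theorem rot_sqRadius (hb : Function.Injective b) (i j : ι) : rot b i j (sqRadius b) = 0 := by
  classical
  have h (k : ι) : pderiv (b k) (sqRadius b) = 2 * X (b k) := by
    simp [sqRadius, pderiv_X, Pi.single_apply, hb.eq_iff, Finset.sum_add_distrib, two_mul]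
  rw [rot_apply, h, h]
  ring

theorem sum_sum_add_swap_sub {M : Type*} [CommRing M] (f g : ι → ι → M) :
    ∑ i, ∑ j, (f i j + f j i - (g i j + g j i)) = 2 * (∑ i, ∑ j, f i j) - 2 * ∑ i, ∑ j, g i j := by
  have h (f : ι → ι → M) : ∑ i, ∑ j, f j i = ∑ i, ∑ j, f i j := Finset.sum_comm
  simp only [Finset.sum_add_distrib, Finset.sum_sub_distrib, h f, h g, two_mul]

/-- The splitting of the flat Laplace operator into radial and angular parts. Expanding the square
of a rotation gives four terms, which the swap of `i` and `j` pairs into two double sums. -/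
theorem casimir_eq (hb : Function.Injective b) (P : MvPolynomial σ ℂ) :
    casimir b P = sqRadius b * laplace b P - euler b (euler b P) -
      ((Fintype.card ι : ℂ) - 2) • euler b P := by
  classical
  have hE : euler b (euler b P) = euler b P +
      ∑ i, ∑ j, X (b i) * (X (b j) * pderiv (b i) (pderiv (b j) P)) := by
    simp only [euler_apply, map_sum, pderiv_mul_X hb, mul_add, Finset.sum_add_distrib]
    rw [add_comm]
    simp only [mul_ite, mul_zero, Finset.sum_ite_eq, Finset.mem_univ, if_true]
    exact congrArg _ Finset.sum_comm
  have h₁ : ∑ i, ∑ j, X (b i) * pderiv (b j) (X (b i) * pderiv (b j) P) =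
      euler b P + sqRadius b * laplace b P := by
    simp only [euler_apply, pderiv_mul_X hb, mul_add, Finset.sum_add_distrib, sqRadius,
      laplace_apply, Finset.sum_mul_sum, mul_assoc]
    rw [add_comm]
    simp
  have h₂ : ∑ i, ∑ j, X (b i) * pderiv (b j) (X (b j) * pderiv (b i) P) =
      (Fintype.card ι : ℂ) • euler b P +
        ∑ i, ∑ j, X (b i) * (X (b j) * pderiv (b i) (pderiv (b j) P)) := by
    simp only [euler_apply, pderiv_mul_X hb, mul_add, Finset.sum_add_distrib]
    rw [add_comm]
    refine congrArg₂ (· + ·) ?_ ?_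
    · simp [Finset.smul_sum, MvPolynomial.smul_eq_C_mul]
    · exact Finset.sum_congr rfl fun i _ => Finset.sum_congr rfl fun j _ => by
        rw [pderiv_comm (b j) (b i) P]
  have h₃ : ∑ i, ∑ j, rot b i j (rot b i j P) =
      2 * (∑ i, ∑ j, X (b i) * pderiv (b j) (X (b i) * pderiv (b j) P)) -
      2 * ∑ i, ∑ j, X (b i) * pderiv (b j) (X (b j) * pderiv (b i) P) := by
    have h (i j : ι) : rot b i j (rot b i j P) =
        X (b i) * pderiv (b j) (X (b i) * pderiv (b j) P) +
        X (b j) * pderiv (b i) (X (b j) * pderiv (b i) P) -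
        (X (b i) * pderiv (b j) (X (b j) * pderiv (b i) P) +
        X (b j) * pderiv (b i) (X (b i) * pderiv (b j) P)) := by
      simp only [rot_apply, map_sub]
      generalize pderiv (b j) (X (b i) * pderiv (b j) P) = a₁
      generalize pderiv (b i) (X (b j) * pderiv (b i) P) = a₂
      generalize pderiv (b j) (X (b j) * pderiv (b i) P) = a₃
      generalize pderiv (b i) (X (b i) * pderiv (b j) P) = a₄
      ring
    exact (Finset.sum_congr rfl fun i _ => Finset.sum_congr rfl fun j _ => h i j).trans
      (sum_sum_add_swap_sub (fun i j => X (b i) * pderiv (b j) (X (b i) * pderiv (b j) P))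
        fun i j => X (b i) * pderiv (b j) (X (b j) * pderiv (b i) P))
  rw [casimir_apply, h₃, h₁, h₂, hE]
  generalize (∑ i, ∑ j, X (b i) * (X (b j) * pderiv (b i) (pderiv (b j) P))) = A
  generalize euler b P = B
  generalize sqRadius b * laplace b P = D
  have h₄ (Q : MvPolynomial σ ℂ) : 2 * Q = (2 : ℂ) • Q := by rw [two_smul, two_mul]
  rw [h₄, h₄]
  module

/-- The first-order part `2 (r² ∂_k - x_k E)` of the commutator with a coordinate is, on the unit
sphere, twice the tangential gradient of that coordinate. This is where the boosts come from. -/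
theorem casimir_X_mul (hb : Function.Injective b) (k : ι) (P : MvPolynomial σ ℂ) :
    casimir b (X (b k) * P) = X (b k) * casimir b P + 2 * (sqRadius b * pderiv (b k) P) -
      2 * (X (b k) * euler b P) - ((Fintype.card ι : ℂ) - 1) • (X (b k) * P) := by
  classical
  have hΔ : laplace b (X (b k) * P) = X (b k) * laplace b P + 2 * pderiv (b k) P := by
    simp only [laplace_apply, pderiv_mul_X hb, map_add, Finset.sum_add_distrib, Finset.mul_sum,
      apply_ite (pderiv _), map_zero]
    simp [two_mul, add_assoc]
  have hX : euler b (X (b k)) = X (b k) := by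
    have := pderiv_mul_X hb (P := 1) k
    simp only [mul_one] at this
    simp [euler_apply, this]
  simp only [casimir_eq hb, hΔ, Derivation.leibniz, hX, smul_eq_mul, map_add,
    MvPolynomial.smul_eq_C_mul, map_sub, map_ofNat, map_one]
  ring

theorem euler_monomial (d : σ →₀ ℕ) (r : ℂ) :
    euler b (monomial d r) = (∑ i, d (b i) : ℕ) • monomial d r := by
  rw [euler_apply, Finset.sum_smul]
  exact Finset.sum_congr rfl fun i _ => X_mul_pderiv_monomial

theorem coeff_euler (d : σ →₀ ℕ) (P : MvPolynomial σ ℂ) :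
    coeff d (euler b P) = (∑ i, d (b i) : ℕ) • coeff d P := by
  classical
  induction P using MvPolynomial.induction_on' with
  | monomial c r =>
    rw [euler_monomial, coeff_smul, coeff_monomial]
    split_ifs with h
    · rw [h]
    · simp
  | add P Q hP hQ => rw [map_add, coeff_add, hP, hQ, coeff_add, smul_add]

/-- The Euler operator multiplies each monomial by its degree in the block, a natural number, so it
has no negative eigenvalue. -/
theorem eq_zero_of_euler_eq {m : ℤ} (hm : m < 0) {P : MvPolynomial σ ℂ}
    (h : euler b P = (m : ℂ) • P) : P = 0 := by
  ext d
  have h₁ := congrArg (coeff d) h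
  rw [coeff_euler, coeff_smul, nsmul_eq_mul, smul_eq_mul] at h₁
  have h₂ : ((∑ i, d (b i) : ℕ) : ℂ) - (m : ℂ) ≠ 0 := by
    have : ((∑ i, d (b i) : ℕ) : ℤ) - m ≠ 0 := by omega
    exact_mod_cast this
  have h₃ : (((∑ i, d (b i) : ℕ) : ℂ) - (m : ℂ)) * coeff d P = 0 := by linear_combination h₁
  exact (mul_eq_zero.1 h₃).resolve_left h₂

theorem euler_pderiv (hb : Function.Injective b) (k : ι) (P : MvPolynomial σ ℂ) :
    euler b (pderiv (b k) P) = pderiv (b k) (euler b P) - pderiv (b k) P := by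
  classical
  simp only [euler_apply, map_sum, pderiv_mul_X hb, Finset.sum_add_distrib,
    pderiv_comm (b k)]
  simp

theorem euler_laplace (hb : Function.Injective b) (P : MvPolynomial σ ℂ) :
    euler b (laplace b P) = laplace b (euler b P) - (2 : ℂ) • laplace b P := by
  simp only [laplace_apply, map_sum, euler_pderiv hb, map_sub, Finset.sum_sub_distrib]
  rw [two_smul]
  abel

end Block

end LightCone

/-! ### Integral spectrum of the Laplace operator of the two spheres -/

namespace LightCone

section Multiplication

open MvPolynomial

variable (p q : ℕ)

/-- Complex polynomials in the coordinates `(x, y)` of `ℝ^p ⊕ ℝ^q`. -/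
abbrev Poly : Type := MvPolynomial (Fin p ⊕ Fin q) ℂ

/-- The block of variables `x`. -/
abbrev xVar : Fin p → Fin p ⊕ Fin q := Sum.inl

/-- The block of variables `y`. -/
abbrev yVar : Fin q → Fin p ⊕ Fin q := Sum.inr

/-- The sum of the Laplace operators of the two spheres. -/
noncomputable def sphereLaplace : Module.End ℂ (Poly p q) :=
  casimir (xVar p q) + casimir (yVar p q)

/-- The polynomials `P` that are killed by a product of factors `L - e`, with `L` the Laplace
operator of the two spheres and the `e` integers that are congruent to `s` modulo `2`. -/
def spectral (s : ℤ) : Submodule ℂ (Poly p q) where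
  carrier := {P | ∃ l : List ℤ, (∀ e ∈ l, e ≡ s [ZMOD 2]) ∧ Polynomial.aeval (sphereLaplace p q)
    (l.map fun e : ℤ => Polynomial.X - Polynomial.C (e : ℂ)).prod P = 0}
  zero_mem' := ⟨[], by simp, by simp⟩
  add_mem' := by
    rintro P Q ⟨l, hl, hP⟩ ⟨m, hm, hQ⟩
    refine ⟨l ++ m, fun e he => (List.mem_append.1 he).elim (hl e) (hm e), ?_⟩
    rw [List.map_append, List.prod_append, map_add]
    nth_rw 1 [mul_comm]
    rw [map_mul, map_mul, Module.End.mul_apply, Module.End.mul_apply, hP, hQ, map_zero, map_zero,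
      add_zero]
  smul_mem' := by
    rintro c P ⟨l, hl, hP⟩
    exact ⟨l, hl, by rw [map_smul, hP, smul_zero]⟩

/-- The polynomials with a given bidegree, as joint eigenspace of the two Euler operators. -/
def bidegree (m n : ℤ) : Submodule ℂ (Poly p q) where
  carrier := {P | euler (xVar p q) P = (m : ℂ) • P ∧ euler (yVar p q) P = (n : ℂ) • P}
  zero_mem' := by simp
  add_mem' := by
    rintro P Q ⟨h₁, h₂⟩ ⟨h₃, h₄⟩
    exact ⟨by rw [map_add, h₁, h₃, smul_add], by rw [map_add, h₂, h₄, smul_add]⟩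
  smul_mem' := by
    rintro c P ⟨h₁, h₂⟩
    exact ⟨by rw [Derivation.map_smul, h₁, smul_comm], by rw [Derivation.map_smul, h₂, smul_comm]⟩

variable {p q}

theorem sphereLaplace_apply (P : Poly p q) :
    sphereLaplace p q P = casimir (xVar p q) P + casimir (yVar p q) P := rfl

theorem spectral_of_sub_smul {s e : ℤ} (he : e ≡ s [ZMOD 2]) {P : Poly p q}
    (h : sphereLaplace p q P - (e : ℂ) • P ∈ spectral p q s) : P ∈ spectral p q s := by
  obtain ⟨l, hl, hP⟩ := h
  refine ⟨l ++ [e], ?_, ?_⟩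
  · simpa [or_imp, forall_and, he] using hl
  · rw [List.map_append, List.prod_append, map_mul, Module.End.mul_apply]
    simpa [Algebra.smul_def] using hP

theorem mul_mem_spectral {s : ℤ} {N P : Poly p q} (hP : P ∈ spectral p q s)
    (hN : ∀ Q : Poly p q, sphereLaplace p q (N * Q) = N * sphereLaplace p q Q) :
    N * P ∈ spectral p q s := by
  obtain ⟨l, hl, hP⟩ := hP
  refine ⟨l, hl, ?_⟩
  have h : Commute (sphereLaplace p q) (LinearMap.mulLeft ℂ N) := LinearMap.ext fun Q => hN Q
  have h' (π : Polynomial ℂ) : Commute (Polynomial.aeval (sphereLaplace p q) π)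
      (LinearMap.mulLeft ℂ N) := by
    induction π using Polynomial.induction_on' with
    | add a b ha hb => rw [map_add]; exact ha.add_left hb
    | monomial n c =>
      rw [Polynomial.aeval_monomial]
      exact (Algebra.commute_algebraMap_left c _).mul_left (h.pow_left n)
  have h₂ := congrArg (fun f : Module.End ℂ (Poly p q) => f P)
    (h' (l.map fun e : ℤ => Polynomial.X - Polynomial.C (e : ℂ)).prod).eq
  simp only [Module.End.mul_apply, LinearMap.mulLeft_apply, hP, mul_zero] at h₂
  exact h₂

theorem pderiv_sqRadius_of_disjoint {ι κ σ : Type*} [Fintype ι] {b : ι → σ} {c : κ → σ}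
    (h : ∀ i j, b i ≠ c j) (j : κ) : pderiv (c j) (sqRadius b) = 0 := by
  classical
  simp [sqRadius, pderiv_X_of_ne (h _ _)]

theorem sphereLaplace_sqRadius_x_mul (P : Poly p q) :
    sphereLaplace p q (sqRadius (xVar p q) * P) = sqRadius (xVar p q) * sphereLaplace p q P := by
  rw [sphereLaplace_apply, rot_mul_of_rot_eq_zero (rot_sqRadius Sum.inl_injective),
    rot_mul_of_rot_eq_zero (pderiv_eq_zero_rot (pderiv_sqRadius_of_disjoint fun _ _ => by simp)),
    sphereLaplace_apply, mul_add]

theorem sphereLaplace_sqRadius_y_mul (P : Poly p q) :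
    sphereLaplace p q (sqRadius (yVar p q) * P) = sqRadius (yVar p q) * sphereLaplace p q P := by
  rw [sphereLaplace_apply, rot_mul_of_rot_eq_zero (rot_sqRadius Sum.inr_injective),
    rot_mul_of_rot_eq_zero (pderiv_eq_zero_rot (pderiv_sqRadius_of_disjoint fun _ _ => by simp)),
    sphereLaplace_apply, mul_add]

theorem euler_laplace_of_disjoint {ι κ σ : Type*} [Fintype ι] [Fintype κ] {b : ι → σ} {c : κ → σ}
    (h : ∀ i j, b i ≠ c j) (P : MvPolynomial σ ℂ) :
    euler b (laplace c P) = laplace c (euler b P) := by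
  classical
  have h₁ (i : κ) (P : MvPolynomial σ ℂ) :
      euler b (pderiv (c i) P) = pderiv (c i) (euler b P) := by
    simp only [euler_apply, map_sum, Derivation.leibniz, pderiv_X_of_ne (h _ _), smul_eq_mul, mul_zero,
      add_zero, pderiv_comm (c i)]
  simp only [laplace_apply, map_sum, h₁]

theorem laplace_x_mem_bidegree {m n : ℤ} {P : Poly p q} (hP : P ∈ bidegree p q m n) :
    laplace (xVar p q) P ∈ bidegree p q (m - 2) n := by
  constructor
  · rw [euler_laplace Sum.inl_injective, hP.1, map_smul, ← sub_smul]
    push_cast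
    rfl
  · rw [euler_laplace_of_disjoint (fun _ _ => by simp), hP.2, map_smul]

theorem laplace_y_mem_bidegree {m n : ℤ} {P : Poly p q} (hP : P ∈ bidegree p q m n) :
    laplace (yVar p q) P ∈ bidegree p q m (n - 2) := by
  constructor
  · rw [euler_laplace_of_disjoint (fun _ _ => by simp), hP.1, map_smul]
  · rw [euler_laplace Sum.inr_injective, hP.2, map_smul, ← sub_smul]
    push_cast
    rfl

theorem spectral_congr {s t : ℤ} (h : s ≡ t [ZMOD 2]) : spectral p q s = spectral p q t := by
  ext P
  exact exists_congr fun l => and_congr_left' (forall₂_congr fun e _ =>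
    ⟨fun h' => h'.trans h, fun h' => h'.trans h.symm⟩)

/-- By `casimir_eq`, in bidegree `(m, n)` the operator `L - e` with `e = -(m(m+p-2) + n(n+q-2))` is
`|x|² Δ_x + |y|² Δ_y`. The Laplacians lower `m` or `n` by two, which preserves the parity class, and
`L` commutes with `|x|²` and `|y|²`, so induction on the total degree applies. -/
theorem bidegree_le_spectral_aux (N : ℕ) : ∀ (m n : ℤ), m + n < N →
    bidegree p q m n ≤ spectral p q ((p + 1) * m + (q + 1) * n) := by
  induction N with
  | zero =>
    intro m n h P hP
    rcases lt_or_ge m 0 with hm | hm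
    · rw [eq_zero_of_euler_eq hm hP.1]; exact zero_mem _
    · rw [eq_zero_of_euler_eq (by push_cast at h; omega) hP.2]; exact zero_mem _
  | succ N ih =>
    intro m n h P hP
    have hx := ih (m - 2) n (by push_cast at h; omega) (laplace_x_mem_bidegree hP)
    have hy := ih m (n - 2) (by push_cast at h; omega) (laplace_y_mem_bidegree hP)
    rw [spectral_congr (t := (p + 1) * m + (q + 1) * n)
      (by rw [Int.modEq_iff_dvd]; exact ⟨p + 1, by ring⟩)] at hx
    rw [spectral_congr (t := (p + 1) * m + (q + 1) * n)
      (by rw [Int.modEq_iff_dvd]; exact ⟨q + 1, by ring⟩)] at hy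
    refine spectral_of_sub_smul (e := -(m * m + (p - 2) * m + n * n + (q - 2) * n)) ?_ ?_
    · rw [Int.modEq_iff_dvd]
      -- The difference to be halved is `m(m+1) + n(n+1) + 2(p-1)m + 2(q-1)n`.
      obtain ⟨k, hk⟩ := (Int.even_mul_succ_self m).two_dvd
      obtain ⟨k', hk'⟩ := (Int.even_mul_succ_self n).two_dvd
      exact ⟨k + k' + (p - 1) * m + (q - 1) * n, by linear_combination hk + hk'⟩
    · convert (spectral p q ((p + 1) * m + (q + 1) * n)).add_mem
        (mul_mem_spectral hx sphereLaplace_sqRadius_x_mul)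
        (mul_mem_spectral hy sphereLaplace_sqRadius_y_mul) using 1
      rw [sphereLaplace_apply, casimir_eq Sum.inl_injective, casimir_eq Sum.inr_injective, hP.1,
        hP.2, Derivation.map_smul, Derivation.map_smul, hP.1, hP.2]
      simp only [Fintype.card_fin]
      push_cast
      module

theorem bidegree_le_spectral (m n : ℤ) :
    bidegree p q m n ≤ spectral p q ((p + 1) * m + (q + 1) * n) :=
  bidegree_le_spectral_aux (m + n + 1).toNat m n (by omega)

end Multiplication

end LightCone

/-! ### Multiplication by `x_i y_j` recovered from the boosts -/

namespace LightCone

section Multiplication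

open MvPolynomial

variable {p q : ℕ}

theorem sphereLaplace_mul (i : Fin p) (j : Fin q) (P : Poly p q) :
    sphereLaplace p q (X (xVar p q i) * (X (yVar p q j) * P)) =
      X (xVar p q i) * (X (yVar p q j) * sphereLaplace p q P) +
      2 * (sqRadius (xVar p q) * (X (yVar p q j) * pderiv (xVar p q i) P)) +
      2 * (sqRadius (yVar p q) * (X (xVar p q i) * pderiv (yVar p q j) P)) -
      2 * (X (xVar p q i) * (X (yVar p q j) * (euler (xVar p q) P + euler (yVar p q) P))) -
      ((p : ℂ) + q - 2) • (X (xVar p q i) * (X (yVar p q j) * P)) := by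
  have h₁ : pderiv (xVar p q i) (X (yVar p q j) * P) = X (yVar p q j) * pderiv (xVar p q i) P := by
    simp
  have h₂ : euler (xVar p q) (X (yVar p q j) * P) = X (yVar p q j) * euler (xVar p q) P := by
    simp [euler_apply, Finset.mul_sum, mul_left_comm]
  have h₃ (P) : casimir (yVar p q) (X (xVar p q i) * P) = X (xVar p q i) * casimir (yVar p q) P :=
    rot_mul_of_rot_eq_zero (pderiv_eq_zero_rot fun _ => pderiv_X_of_ne (by simp)) P
  have h₄ : casimir (xVar p q) (X (yVar p q j) * P) = X (yVar p q j) * casimir (xVar p q) P :=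
    rot_mul_of_rot_eq_zero (pderiv_eq_zero_rot fun _ => pderiv_X_of_ne (by simp)) P
  rw [sphereLaplace_apply, casimir_X_mul Sum.inl_injective, h₃, casimir_X_mul Sum.inr_injective,
    h₁, h₂, h₄, sphereLaplace_apply]
  simp only [MvPolynomial.smul_eq_C_mul, map_sub, map_add, Fintype.card_fin, map_one, map_ofNat]
  ring

/-- The action of the infinitesimal boost `x_i ∂_{y_j} + y_j ∂_{x_i}` on polynomials, which stand
for functions on the light cone that are homogeneous of degree `a`. -/
noncomputable def boost (a : ℂ) (i : Fin p) (j : Fin q) (P : Poly p q) : Poly p q :=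
  a • (X (xVar p q i) * (X (yVar p q j) * P)) + X (yVar p q j) * pderiv (xVar p q i) P +
    X (xVar p q i) * pderiv (yVar p q j) P -
    X (xVar p q i) * (X (yVar p q j) * (euler (xVar p q) P + euler (yVar p q) P))

/-- The commutator of `L` with `x_i y_j` is a boost up to a scalar multiple of `x_i y_j` itself.
Since polynomials are not reduced modulo the sphere equations, multiples of those equations appear
as corrections. -/
theorem two_smul_boost (a : ℂ) (i : Fin p) (j : Fin q) (P : Poly p q) :
    (2 * a + p + q - 2) • (X (xVar p q i) * (X (yVar p q j) * P)) +
      sphereLaplace p q (X (xVar p q i) * (X (yVar p q j) * P)) -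
      X (xVar p q i) * (X (yVar p q j) * sphereLaplace p q P) =
    (2 : ℂ) • boost a i j P + (2 : ℂ) • ((sqRadius (xVar p q) - 1) * (X (yVar p q j) * pderiv (xVar p q i) P)) +
      (2 : ℂ) • ((sqRadius (yVar p q) - 1) * (X (xVar p q i) * pderiv (yVar p q j) P)) := by
  rw [sphereLaplace_mul, boost]
  simp only [MvPolynomial.smul_eq_C_mul, map_sub, map_add, map_mul, map_ofNat]
  ring

/-- The sign with which the twist below acts on a variable. -/
def twistSign (p q : ℕ) : Fin p ⊕ Fin q → ℂ :=
  Sum.elim (fun _ => (-1) ^ (p + 1)) fun _ => (-1) ^ (q + 1)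

/-- The algebra automorphism that multiplies the variables by the signs `twistSign`. -/
noncomputable def twist (p q : ℕ) : Poly p q →ₐ[ℂ] Poly p q :=
  aeval fun k => C (twistSign p q k) * X k

theorem twist_X (k : Fin p ⊕ Fin q) : twist p q (X k) = C (twistSign p q k) * X k :=
  aeval_X _ k

theorem pderiv_twist (k : Fin p ⊕ Fin q) (P : Poly p q) :
    pderiv k (twist p q P) = C (twistSign p q k) * twist p q (pderiv k P) := by
  classical
  induction P using MvPolynomial.induction_on with
  | C r => simp [twist]
  | add P Q hP hQ => simp only [map_add, hP, hQ, mul_add]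
  | mul_X P l hP =>
    by_cases h : l = k
    · subst h
      simp only [map_mul, Derivation.leibniz, hP, twist_X, pderiv_X_self, smul_eq_mul, map_add,
        Derivation.leibniz, pderiv_C, map_one]
      ring
    · simp only [map_mul, Derivation.leibniz, hP, twist_X, pderiv_X_of_ne h,
        smul_eq_mul, map_add, pderiv_C, map_zero, mul_zero]
      ring

theorem twist_rot {ι : Type*} {b : ι → Fin p ⊕ Fin q}
    (h : ∀ i j, twistSign p q (b i) = twistSign p q (b j)) (i j : ι) (P : Poly p q) :
    rot b i j (twist p q P) = twist p q (rot b i j P) := by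
  simp only [rot_apply, pderiv_twist, map_sub, map_mul, twist_X, h i j]
  ring

theorem twist_sphereLaplace (P : Poly p q) :
    sphereLaplace p q (twist p q P) = twist p q (sphereLaplace p q P) := by
  simp only [sphereLaplace_apply, casimir_apply, map_add, map_smul, map_sum,
    twist_rot (b := xVar p q) (fun _ _ => rfl), twist_rot (b := yVar p q) (fun _ _ => rfl)]

theorem twist_monomial (d : Fin p ⊕ Fin q →₀ ℕ) (r : ℂ) :
    twist p q (monomial d r) =
      (-1 : ℂ) ^ ((p + 1) * ∑ i, d (xVar p q i) + (q + 1) * ∑ j, d (yVar p q j)) • monomial d r := by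
  rw [twist, aeval_monomial, monomial_eq, MvPolynomial.smul_eq_C_mul, Finsupp.prod_fintype _ _
    (by simp), Finsupp.prod_fintype _ _ (by simp)]
  simp only [mul_pow, Finset.prod_mul_distrib, MvPolynomial.algebraMap_eq]
  have : ∏ k, (C (twistSign p q k) : Poly p q) ^ d k =
      C ((-1 : ℂ) ^ ((p + 1) * ∑ i, d (xVar p q i) + (q + 1) * ∑ j, d (yVar p q j))) := by
    rw [Fintype.prod_sum_type]
    simp only [twistSign, Sum.elim_inl, Sum.elim_inr, ← map_pow, Finset.prod_pow_eq_pow_sum,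
      ← map_prod, ← map_mul]
    rw [← pow_mul, ← pow_mul, ← pow_add]
  rw [this]
  ring

/-- On bidegree `(m, n)` the twist is the sign `(-1)^((p+1)m+(q+1)n)`, the parity of the eigenvalues
of `L`. Symmetrising with the sign `(-1)^s` thus keeps exactly the monomials of parity `s`. -/
theorem add_twist_mem_spectral (s : ℕ) (P : Poly p q) :
    P + (-1 : ℂ) ^ s • twist p q P ∈ spectral p q s := by
  induction P using MvPolynomial.induction_on' with
  | add P Q hP hQ =>
    rw [map_add, smul_add, add_add_add_comm]
    exact add_mem hP hQ
  | monomial d r =>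
    set m := ∑ i, d (xVar p q i) with hm
    set n := ∑ j, d (yVar p q j) with hn
    have hd : monomial d r ∈ bidegree p q m n :=
      ⟨by rw [euler_monomial, Int.cast_natCast, Nat.cast_smul_eq_nsmul],
        by rw [euler_monomial, Int.cast_natCast, Nat.cast_smul_eq_nsmul]⟩
    have h := bidegree_le_spectral _ _ hd
    rw [twist_monomial, ← hm, ← hn, smul_smul, ← pow_add]
    rcases Nat.even_or_odd (s + ((p + 1) * m + (q + 1) * n)) with he | ho
    · rw [he.neg_one_pow, one_smul]
      obtain ⟨k, hk⟩ := he
      have hs : (s : ℤ) ≡ (p + 1) * m + (q + 1) * n [ZMOD 2] := by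
        rw [Int.modEq_iff_dvd]
        exact ⟨k - s, by zify at hk; linear_combination hk⟩
      rw [spectral_congr hs]
      exact add_mem h h
    · rw [ho.neg_one_pow, neg_one_smul, add_neg_cancel]
      exact zero_mem _

theorem mem_spectral_of_twist {s : ℕ} {P : Poly p q} (h : twist p q P = (-1 : ℂ) ^ s • P) :
    P ∈ spectral p q s := by
  have h' := add_twist_mem_spectral s P
  rw [h, smul_smul, ← pow_add, Even.neg_one_pow ⟨s, rfl⟩, one_smul] at h'
  have h₂ := (spectral p q s).smul_mem (1 / 2 : ℂ) h'
  convert h₂ using 1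
  module

theorem isCoprime_factors {c : ℂ} {l : List ℤ} (h : ∀ e ∈ l, c ≠ e) :
    IsCoprime (Polynomial.X - Polynomial.C c)
      (l.map fun e : ℤ => Polynomial.X - Polynomial.C (e : ℂ)).prod := by
  induction l with
  | nil => simpa using isCoprime_one_right
  | cons e l ih =>
    rw [List.map_cons, List.prod_cons]
    refine IsCoprime.mul_right ?_ (ih fun e' he' => h e' (List.mem_cons_of_mem _ he'))
    exact Polynomial.isCoprime_X_sub_C_of_isUnit_sub
      (sub_ne_zero.2 (h e List.mem_cons_self)).isUnit

theorem aeval_mem {V : Type*} [AddCommGroup V] [Module ℂ V] {W : Submodule ℂ V}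
    {L : Module.End ℂ V} (hL : ∀ v ∈ W, L v ∈ W) (π : Polynomial ℂ) {v : V} (hv : v ∈ W) :
    Polynomial.aeval L π v ∈ W := by
  induction π using Polynomial.induction_on' with
  | add a b ha hb => rw [map_add]; exact add_mem ha hb
  | monomial n c =>
    rw [Polynomial.aeval_monomial, Module.End.mul_apply, Module.algebraMap_end_apply]
    refine W.smul_mem _ ?_
    induction n with
    | zero => simpa using hv
    | succ n ih => rw [pow_succ', Module.End.mul_apply]; exact hL _ ih

/-- A space of polynomials that is stable under infinitesimal rotations, boosts and the twist, and
that contains the equations of the product of the two unit spheres. -/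
structure IsBoostStable (a : ℂ) (W : Submodule ℂ (Poly p q)) : Prop where
  rot_x_mem : ∀ i j, ∀ P ∈ W, rot (xVar p q) i j P ∈ W
  rot_y_mem : ∀ i j, ∀ P ∈ W, rot (yVar p q) i j P ∈ W
  boost_mem : ∀ i j, ∀ P ∈ W, boost a i j P ∈ W
  twist_mem : ∀ P ∈ W, twist p q P ∈ W
  sphere_x_mem : ∀ P, (sqRadius (xVar p q) - 1) * P ∈ W
  sphere_y_mem : ∀ P, (sqRadius (yVar p q) - 1) * P ∈ W

variable {a : ℂ} {W : Submodule ℂ (Poly p q)}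

theorem IsBoostStable.sphereLaplace_mem (hW : IsBoostStable a W) {P : Poly p q} (hP : P ∈ W) : sphereLaplace p q P ∈ W := by
  simp only [sphereLaplace_apply, casimir_apply]
  exact add_mem
    (W.smul_mem _ (sum_mem fun i _ => sum_mem fun j _ => hW.rot_x_mem i j _ (hW.rot_x_mem i j _ hP)))
    (W.smul_mem _ (sum_mem fun i _ => sum_mem fun j _ => hW.rot_y_mem i j _ (hW.rot_y_mem i j _ hP)))

/-- Induction on the factors that annihilate `P`. The boost identity and the case of `(L - e) P`
give `(L - c) T ∈ W` for `T = x_i y_j P` and `c = e - (2a+p+q-2)`; since `c` avoids the possible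
eigenvalues on `T`, the factor `L - c` can be removed. -/
theorem IsBoostStable.mul_mem_of_factors (hW : IsBoostStable a W) (ha : ∀ n : ℤ, a ≠ n) (i : Fin p) (j : Fin q) (s : ℕ) (l : List ℤ) :
    ∀ P ∈ W, twist p q P = (-1 : ℂ) ^ s • P → (∀ e ∈ l, e ≡ s [ZMOD 2]) →
      Polynomial.aeval (sphereLaplace p q)
        (l.map fun e : ℤ => Polynomial.X - Polynomial.C (e : ℂ)).prod P = 0 →
      X (xVar p q i) * (X (yVar p q j) * P) ∈ W := by
  induction l with
  | nil =>
    intro P _ _ _ h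
    have : P = 0 := by simpa using h
    simp [this]
  | cons e l ih =>
    intro P hP hs hl h
    set T : Poly p q := X (xVar p q i) * (X (yVar p q j) * P) with hT
    have hL {Q : Poly p q} (hQ : Q ∈ W) := hW.sphereLaplace_mem hQ
    -- the induction hypothesis for `(L - e) P`
    have h₁ := ih (sphereLaplace p q P - (e : ℂ) • P) (sub_mem (hL hP) (W.smul_mem _ hP))
      (by rw [map_sub, ← twist_sphereLaplace, map_smul, hs, map_smul]; module)
      (fun e' he' => hl e' (List.mem_cons_of_mem _ he'))
      (by rw [List.map_cons, List.prod_cons, mul_comm, map_mul, Module.End.mul_apply] at h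
          simpa [Algebra.smul_def] using h)
    have h₂ : (2 * a + p + q - 2) • T + sphereLaplace p q T -
        X (xVar p q i) * (X (yVar p q j) * sphereLaplace p q P) ∈ W := by
      rw [hT, two_smul_boost]
      exact add_mem (add_mem (W.smul_mem _ (hW.boost_mem i j P hP)) (W.smul_mem _ (hW.sphere_x_mem _)))
        (W.smul_mem _ (hW.sphere_y_mem _))
    have h₃ : sphereLaplace p q T - (e - (2 * a + p + q - 2)) • T ∈ W := by
      convert add_mem h₂ h₁ using 1
      rw [hT]
      simp only [MvPolynomial.smul_eq_C_mul, map_sub]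
      ring
    have hTs : twist p q T = (-1 : ℂ) ^ (s + p + q) • T := by
      rw [hT, map_mul, map_mul, hs, twist_X, twist_X]
      simp only [twistSign, Sum.elim_inl, Sum.elim_inr, MvPolynomial.smul_eq_C_mul, pow_add, pow_one,
        map_mul, map_neg, map_one]
      ring
    obtain ⟨l', hl', hl'T⟩ := mem_spectral_of_twist hTs
    -- If `c = e'`, then `2a = e - e' - p - q + 2`, which is even because `e ≡ s` and `e' ≡ s + p +
    -- q`; this contradicts that `a` is not an integer.
    obtain ⟨u, v, huv⟩ := isCoprime_factors (c := e - (2 * a + p + q - 2)) (l := l') (by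
      intro e' he' hc
      have h₄ : (s : ℤ) + p + q ≡ e' [ZMOD 2] := by simpa using (hl' e' he').symm
      have h₅ := (hl e List.mem_cons_self)
      obtain ⟨k, hk⟩ := Int.modEq_iff_dvd.1 h₄
      obtain ⟨k', hk'⟩ := Int.modEq_iff_dvd.1 h₅
      refine ha (1 - k - k' - p - q) ?_
      have hk₂ : (e' : ℂ) - (s + p + q) = 2 * k := by exact_mod_cast hk
      have hk₃ : (s : ℂ) - e = 2 * k' := by exact_mod_cast hk'
      push_cast
      linear_combination -hc / 2 - hk₂ / 2 - hk₃ / 2)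
    -- The Bézout identity applied to `T`: the second product kills `T`, so `T = u(L) (L - c) T`,
    -- and `W` is stable under `L`.
    have h₆ := congrArg (fun π => Polynomial.aeval (sphereLaplace p q) π T) huv
    simp only [map_add, map_mul, map_one, Module.End.mul_apply, LinearMap.add_apply, hl'T,
      map_zero, add_zero, Module.End.one_apply] at h₆
    rw [← h₆]
    refine aeval_mem (fun _ => hL) u ?_
    rw [map_sub, Polynomial.aeval_X, Polynomial.aeval_C, LinearMap.sub_apply,
      Module.algebraMap_end_apply]
    exact h₃

/-- The twist is an involution that preserves `W`, so `P` is half the sum of two twist eigenvectors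
in `W`, each with eigenvalues of one parity. -/
theorem IsBoostStable.mul_mem (hW : IsBoostStable a W) (ha : ∀ n : ℤ, a ≠ n) (i : Fin p) (j : Fin q)
    {P : Poly p q} (hP : P ∈ W) : X (xVar p q i) * (X (yVar p q j) * P) ∈ W := by
  have htt (Q : Poly p q) : twist p q (twist p q Q) = Q := by
    have : (twist p q).comp (twist p q) = AlgHom.id ℂ _ := by
      refine MvPolynomial.algHom_ext fun k => ?_
      rw [AlgHom.comp_apply, twist_X, map_mul, twist_X, AlgHom.id_apply]
      rcases k with k | k <;> simp [twist, twistSign, ← mul_assoc, ← pow_add, ← two_mul]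
    exact congrArg (fun f : Poly p q →ₐ[ℂ] Poly p q => f Q) this
  have key (s : ℕ) : X (xVar p q i) * (X (yVar p q j) * (P + (-1 : ℂ) ^ s • twist p q P)) ∈ W := by
    have hs : twist p q (P + (-1 : ℂ) ^ s • twist p q P) =
        (-1 : ℂ) ^ s • (P + (-1 : ℂ) ^ s • twist p q P) := by
      rw [map_add, map_smul, htt, smul_add, smul_smul, ← pow_add, Even.neg_one_pow ⟨s, rfl⟩,
        one_smul, add_comm]
    obtain ⟨l, hl, h⟩ := mem_spectral_of_twist hs
    exact hW.mul_mem_of_factors ha i j s l _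
      (add_mem hP (W.smul_mem _ (hW.twist_mem P hP))) hs hl h
  convert W.smul_mem (1 / 2 : ℂ) (add_mem (key 0) (key 1)) using 1
  have h₁ : P + (-1 : ℂ) ^ 0 • twist p q P + (P + (-1 : ℂ) ^ 1 • twist p q P) = (2 : ℂ) • P := by
    module
  rw [← mul_add, ← mul_add, h₁, mul_smul_comm, mul_smul_comm, smul_smul]
  norm_num

end Multiplication

end LightCone

namespace LightCone

open MeasureTheory Filter

variable {p q : ℕ}

/-! ### Extension of functions from the cone -/

theorem form_self (w : Ambient p q) : form w w = ‖w.1‖ ^ 2 - ‖w.2‖ ^ 2 := by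
  simp only [form, EuclideanSpace.norm_sq_eq, Real.norm_eq_abs, sq_abs]
  simp only [sq]

theorem norm_fst_eq_norm_snd {w : Ambient p q} (hw : w ∈ cone p q) : ‖w.1‖ = ‖w.2‖ := by
  have h := hw.2
  rw [form_self, sub_eq_zero] at h
  exact (sq_eq_sq₀ (norm_nonneg _) (norm_nonneg _)).1 h

/-- The open set of all `(x, y)` with `x ≠ 0` and `y ≠ 0`, which contains the cone. -/
def neighborhood (p q : ℕ) : Set (Ambient p q) := {w | w.1 ≠ 0 ∧ w.2 ≠ 0}

theorem isOpen_neighborhood : IsOpen (neighborhood p q) :=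
  (isOpen_ne.preimage continuous_fst).inter (isOpen_ne.preimage continuous_snd)

theorem mem_neighborhood {w : Ambient p q} (hw : w ∈ cone p q) : w ∈ neighborhood p q := by
  have h := norm_fst_eq_norm_snd hw
  constructor
  · intro h₁
    rw [h₁, norm_zero] at h
    exact hw.1 (Prod.ext h₁ (norm_eq_zero.1 h.symm))
  · intro h₁
    rw [h₁, norm_zero] at h
    exact hw.1 (Prod.ext (norm_eq_zero.1 h) h₁)

theorem mem_cone_iff {w : Ambient p q} : w ∈ cone p q ↔ w ∈ neighborhood p q ∧ ‖w.1‖ = ‖w.2‖ := by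
  refine ⟨fun h => ⟨mem_neighborhood h, norm_fst_eq_norm_snd h⟩, fun h => ⟨fun h₀ => h.1.1 ?_, ?_⟩⟩
  · rw [h₀]; rfl
  · rw [form_self, h.2, sub_self]

/-- The retraction `(x, y) ↦ (x, (|x| / |y|) y)` onto the cone. -/
noncomputable def retraction (w : Ambient p q) : Ambient p q := (w.1, (‖w.1‖ / ‖w.2‖) • w.2)

theorem retraction_mem {w : Ambient p q} (hw : w ∈ neighborhood p q) : retraction w ∈ cone p q := by
  have h₁ := norm_ne_zero_iff.2 hw.1
  have h₂ := norm_ne_zero_iff.2 hw.2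
  refine mem_cone_iff.2 ⟨⟨hw.1, smul_ne_zero (div_ne_zero h₁ h₂) hw.2⟩, ?_⟩
  simp only [retraction, norm_smul, norm_div, norm_norm]
  field_simp

theorem retraction_eq {w : Ambient p q} (hw : w ∈ cone p q) : retraction w = w := by
  have h := norm_ne_zero_iff.2 (mem_neighborhood hw).2
  rw [retraction, norm_fst_eq_norm_snd hw, div_self h, one_smul]

theorem contDiffOn_retraction :
    ContDiffOn ℝ ∞ (retraction (p := p) (q := q)) (neighborhood p q) := by
  intro w hw
  refine ContDiffAt.contDiffWithinAt ?_
  have h₁ : ContDiffAt ℝ ∞ (fun w : Ambient p q => ‖w.1‖) w := contDiffAt_fst.norm ℝ hw.1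
  have h₂ : ContDiffAt ℝ ∞ (fun w : Ambient p q => ‖w.2‖) w := contDiffAt_snd.norm ℝ hw.2
  exact contDiffAt_fst.prodMk ((h₁.div h₂ (norm_ne_zero_iff.2 hw.2)).smul contDiffAt_snd)

open Classical in
/-- The extension of a function on the cone that is constant along the retraction. -/
noncomputable def extension (f : cone p q → ℂ) (w : Ambient p q) : ℂ :=
  if h : w ∈ neighborhood p q then f ⟨retraction w, retraction_mem h⟩ else 0

theorem extension_eq (f : cone p q → ℂ) (w : cone p q) : extension f w.1 = f w := by
  rw [extension, dif_pos (mem_neighborhood w.2)]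
  congr 1
  exact Subtype.ext (retraction_eq w.2)

/-- Composition with the retraction replaces the local extensions in the definition of smoothness by
one extension on a fixed open set, without a partition of unity. -/
theorem contDiffOn_extension (f : Smooth p q) : ContDiffOn ℝ ∞ (extension f) (neighborhood p q) := by
  intro w hw
  obtain ⟨U, F, hU, hwU, hF, h⟩ := f.2 ⟨retraction w, retraction_mem hw⟩
  have h₁ := contDiffOn_retraction w hw
  have h₂ : ContDiffWithinAt ℝ ∞ (fun v => F (retraction v)) (neighborhood p q) w :=
    ((hF _ hwU).contDiffAt (hU.mem_nhds hwU)).comp_contDiffWithinAt w h₁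
  refine h₂.congr_of_eventuallyEq ?_ ?_
  · filter_upwards [h₁.continuousWithinAt (hU.mem_nhds hwU), self_mem_nhdsWithin] with v hv hv'
    rw [extension, dif_pos hv']
    exact (h ⟨retraction v, retraction_mem hv'⟩ hv).symm
  · rw [extension, dif_pos hw]
    exact (h _ hwU).symm

/-- Functions that are smooth on a neighborhood of the cone restrict to smooth functions. -/
def ofContDiffOn (F : Ambient p q → ℂ) (hF : ContDiffOn ℝ ∞ F (neighborhood p q)) : Smooth p q :=
  ⟨fun w => F w.1, fun w => ⟨neighborhood p q, F, isOpen_neighborhood, mem_neighborhood w.2, hF,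
    fun _ _ => rfl⟩⟩

theorem Smooth.ext {f g : Smooth p q} (h : ∀ w, f w = g w) : f = g := Subtype.ext (funext h)

theorem rho_apply (g : indefiniteOrthogonalGroup p q) (f : Smooth p q) (w : cone p q) :
    rho p q g f w = f (g⁻¹ • w) := rfl

theorem contDiffOn_extension_comp (f : Smooth p q) :
    ContDiffOn ℝ ∞ (fun z : (Ambient p q →L[ℝ] Ambient p q) × Ambient p q => extension f (z.1 z.2))
      {z | z.1 z.2 ∈ neighborhood p q} :=
  (contDiffOn_extension f).comp
    (contDiff_fst.clm_apply contDiff_snd).contDiffOn fun _ hz => hz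

theorem isOpen_apply_mem_neighborhood :
    IsOpen {z : (Ambient p q →L[ℝ] Ambient p q) × Ambient p q | z.1 z.2 ∈ neighborhood p q} :=
  isOpen_neighborhood.preimage
    (f := fun z : (Ambient p q →L[ℝ] Ambient p q) × Ambient p q => z.1 z.2) (by fun_prop)

theorem jetContinuous_rho {S : Type*} [TopologicalSpace S]
    {ι : S → Ambient p q →L[ℝ] Ambient p q} (hι : Continuous ι)
    {g : S → indefiniteOrthogonalGroup p q} (hg : ∀ s w, (g s)⁻¹.1 w = ι s w) (f : Smooth p q) :
    JetContinuous fun s => rho p q (g s) f := by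
  have h (s) (w : cone p q) : ι s w.1 = ((g s)⁻¹ • w : cone p q).1 := (hg s w.1).symm
  refine jetContinuous_of_contDiffOn hι isOpen_apply_mem_neighborhood (contDiffOn_extension_comp f)
    (fun s w => ?_) fun s w => ?_
  · change ι s w.1 ∈ neighborhood p q
    rw [h]
    exact mem_neighborhood (Subtype.prop _)
  · change _ = extension f (ι s w.1)
    rw [h, extension_eq]
    rfl

/-! ### One-parameter groups -/

section Flow

variable {E : Type*} [NormedAddCommGroup E] [NormedSpace ℝ E]

/-- The flow of a bounded linear vector field. -/
noncomputable def flow (D : E →L[ℝ] E) (s : ℝ) : E →L[ℝ] E := NormedSpace.exp (s • D)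

theorem flow_zero_apply (D : E →L[ℝ] E) (w : E) : flow D 0 w = w := by
  simp [flow]

variable [CompleteSpace E]

theorem hasDerivAt_flow (D : E →L[ℝ] E) (t : ℝ) : HasDerivAt (flow D) (D * flow D t) t :=
  hasDerivAt_exp_smul_const' D t

theorem hasDerivAt_flow_apply (D : E →L[ℝ] E) (w : E) (t : ℝ) :
    HasDerivAt (fun s => flow D s w) (D (flow D t w)) t :=
  (ContinuousLinearMap.apply ℝ E w).hasFDerivAt.comp_hasDerivAt t (hasDerivAt_flow D t)

theorem continuous_flow (D : E →L[ℝ] E) : Continuous (flow D) :=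
  continuous_iff_continuousAt.2 fun t => (hasDerivAt_flow D t).continuousAt

theorem flow_add_apply (D : E →L[ℝ] E) (s t : ℝ) (w : E) :
    flow D (s + t) w = flow D s (flow D t w) := by
  have : NormedAlgebra ℚ (E →L[ℝ] E) := .restrictScalars ℚ ℝ _
  rw [flow, add_smul, NormedSpace.exp_add_of_commute ((Commute.refl D).smul_left s |>.smul_right t)]
  rfl

end Flow

section OneParameter

theorem hasDerivAt_form {γ : ℝ → Ambient p q} {v : Ambient p q} {δ : ℝ → Ambient p q}
    {u : Ambient p q} {t : ℝ} (hγ : HasDerivAt γ v t) (hδ : HasDerivAt δ u t) :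
    HasDerivAt (fun s => form (γ s) (δ s)) (form v (δ t) + form (γ t) u) t := by
  have h₁ {γ : ℝ → Ambient p q} {v : Ambient p q} (h : HasDerivAt γ v t) (i : Fin p) :
      HasDerivAt (fun s => (γ s).1 i) (v.1 i) t :=
    ((EuclideanSpace.proj i : EuclideanSpace ℝ (Fin p) →L[ℝ] ℝ).comp (ContinuousLinearMap.fst ℝ _
      (EuclideanSpace ℝ (Fin q)))).hasFDerivAt.comp_hasDerivAt t h
  have h₂ {γ : ℝ → Ambient p q} {v : Ambient p q} (h : HasDerivAt γ v t) (i : Fin q) :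
      HasDerivAt (fun s => (γ s).2 i) (v.2 i) t :=
    ((EuclideanSpace.proj i : EuclideanSpace ℝ (Fin q) →L[ℝ] ℝ).comp (ContinuousLinearMap.snd ℝ
      (EuclideanSpace ℝ (Fin p)) _)).hasFDerivAt.comp_hasDerivAt t h
  have h := (HasDerivAt.fun_sum fun i (_ : i ∈ Finset.univ) => (h₁ hγ i).mul (h₁ hδ i)).sub
    (HasDerivAt.fun_sum fun i (_ : i ∈ Finset.univ) => (h₂ hγ i).mul (h₂ hδ i))
  refine h.congr_deriv ?_
  simp only [form, Finset.sum_add_distrib]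
  ring

variable {D : Ambient p q →L[ℝ] Ambient p q} (hD : ∀ u v, form (D u) v + form u (D v) = 0)

/-- Skewness of `D` says that the derivative of the form along the flow vanishes. -/
theorem form_exp (hD : ∀ u v, form (D u) v + form u (D v) = 0) (s : ℝ) (u v : Ambient p q) :
    form (flow D s u) (flow D s v) = form u v := by
  have h := is_const_of_deriv_eq_zero
    (f := fun s : ℝ => form (flow D s u) (flow D s v))
    (fun t => (hasDerivAt_form (hasDerivAt_flow_apply D u t)
      (hasDerivAt_flow_apply D v t)).differentiableAt)
    (fun t => by
      rw [(hasDerivAt_form (hasDerivAt_flow_apply D u t) (hasDerivAt_flow_apply D v t)).deriv, hD])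
    s 0
  simpa [flow_zero_apply] using h

/-- The one-parameter group generated by an endomorphism that is skew for the form. -/
noncomputable def expGroup (s : ℝ) : indefiniteOrthogonalGroup p q :=
  ⟨{ (flow D s).toLinearMap with
      invFun := fun w => flow D (-s) w
      left_inv := fun w => by
        change flow D (-s) (flow D s w) = w
        rw [← flow_add_apply, neg_add_cancel]
        exact flow_zero_apply D w
      right_inv := fun w => by
        change flow D s (flow D (-s) w) = w
        rw [← flow_add_apply, add_neg_cancel]
        exact flow_zero_apply D w },
    fun u v => form_exp hD s u v⟩

theorem expGroup_smul (s : ℝ) (w : cone p q) :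
    (expGroup hD s • w : cone p q).1 = flow D s w.1 := rfl

/-- By the group law, the derivative at time `t` of the translates of `f` is the translate of `f'`.
This family is jet-continuous, so `deriv_mem` applies. -/
theorem generator_mem {W : Submodule ℂ (Smooth p q)} (hW : IsClosed (W : Set (Smooth p q)))
    (hinv : ∀ g, ∀ f ∈ W, rho p q g f ∈ W) {f f' : Smooth p q} (hf : f ∈ W)
    (hff' : ∀ w, HasDerivAt (fun s => f (expGroup hD s • w)) (f' w) 0) : f' ∈ W := by
  have hG : JetContinuous fun s : ℝ => rho p q (expGroup hD s)⁻¹ f' :=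
    jetContinuous_rho (continuous_flow D) (fun s w => by rw [inv_inv]; rfl) f'
  have h := deriv_mem hW (F := fun s => rho p q (expGroup hD s)⁻¹ f) hG (fun s => hinv _ _ hf)
    fun w t => by
      have h₁ := hff' (expGroup hD t • w)
      rw [← sub_self t] at h₁
      have h₂ := h₁.comp_sub_const t t
      simp only [rho_apply, inv_inv]
      refine h₂.congr_of_eventuallyEq (Eventually.of_forall fun s => ?_)
      change f _ = f _
      refine congrArg f.1 (Subtype.ext ?_)
      simp only [expGroup_smul]
      rw [← flow_add_apply, sub_add_cancel]
  have h₀ : (expGroup hD 0)⁻¹ = 1 := by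
    rw [inv_eq_one]
    refine Subtype.ext (LinearEquiv.ext fun w => ?_)
    change flow D 0 w = w
    exact flow_zero_apply D w
  change rho p q (expGroup hD 0)⁻¹ f' ∈ W at h
  rwa [h₀, map_one] at h

end OneParameter

end LightCone

namespace LightCone

open MeasureTheory Filter

variable {p q : ℕ}

/-! ### Polynomial functions on the cone -/

open MvPolynomial

/-- The coordinates of a point, divided by `|x|`. -/
noncomputable def unitCoord (w : Ambient p q) (k : Fin p ⊕ Fin q) : ℂ :=
  ((Sum.elim w.1 w.2 k / ‖w.1‖ : ℝ) : ℂ)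

/-- The function `|x|^a P(w / |x|)` attached to a polynomial `P`. -/
noncomputable def polyFun (a : ℂ) (P : Poly p q) (w : Ambient p q) : ℂ :=
  Complex.exp (a * Real.log ‖w.1‖) * eval (unitCoord w) P

theorem contDiffOn_unitCoord (k : Fin p ⊕ Fin q) :
    ContDiffOn ℝ ∞ (fun w : Ambient p q => unitCoord w k) (neighborhood p q) := by
  intro w hw
  refine ContDiffAt.contDiffWithinAt ?_
  have h₁ : ContDiffAt ℝ ∞ (fun w : Ambient p q => ‖w.1‖) w := contDiffAt_fst.norm ℝ hw.1
  have h₂ : ContDiffAt ℝ ∞ (fun w : Ambient p q => Sum.elim w.1 w.2 k) w := by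
    rcases k with i | i
    · exact ((EuclideanSpace.proj i : EuclideanSpace ℝ (Fin p) →L[ℝ] ℝ).comp
        (ContinuousLinearMap.fst ℝ _ (EuclideanSpace ℝ (Fin q)))).contDiff.contDiffAt
    · exact ((EuclideanSpace.proj i : EuclideanSpace ℝ (Fin q) →L[ℝ] ℝ).comp
        (ContinuousLinearMap.snd ℝ (EuclideanSpace ℝ (Fin p)) _)).contDiff.contDiffAt
  exact Complex.ofRealCLM.contDiff.contDiffAt.comp w (h₂.div h₁ (norm_ne_zero_iff.2 hw.1))

theorem contDiffOn_polyFun (a : ℂ) (P : Poly p q) :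
    ContDiffOn ℝ ∞ (polyFun a P) (neighborhood p q) := by
  refine ContDiffOn.mul ?_ ?_
  · intro w hw
    refine ContDiffAt.contDiffWithinAt ?_
    have h₁ : ContDiffAt ℝ ∞ (fun w : Ambient p q => ‖w.1‖) w := contDiffAt_fst.norm ℝ hw.1
    have h₂ := Complex.ofRealCLM.contDiff.contDiffAt.comp w (h₁.log (norm_ne_zero_iff.2 hw.1))
    exact (contDiffAt_const.mul h₂).cexp
  · induction P using MvPolynomial.induction_on with
    | C r => simpa using contDiffOn_const
    | add P Q hP hQ => simpa using hP.add hQ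
    | mul_X P k hP => simpa using hP.mul (contDiffOn_unitCoord k)

/-- `polyFun` as a linear map to the smooth functions on the cone. -/
noncomputable def polyMap (p q : ℕ) (a : ℂ) : Poly p q →ₗ[ℂ] Smooth p q where
  toFun P := ofContDiffOn (polyFun a P) (contDiffOn_polyFun a P)
  map_add' P Q := Smooth.ext fun w => by
    change polyFun a (P + Q) w.1 = polyFun a P w.1 + polyFun a Q w.1
    rw [polyFun, map_add, mul_add]; rfl
  map_smul' c P := Smooth.ext fun w => by
    change polyFun a (c • P) w.1 = c * polyFun a P w.1
    rw [polyFun, smul_eval, polyFun]; ring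

theorem polyMap_apply (a : ℂ) (P : Poly p q) (w : cone p q) :
    polyMap p q a P w = polyFun a P w.1 := rfl

theorem polyFun_mul (a : ℂ) (P Q : Poly p q) (w : Ambient p q) :
    polyFun a (P * Q) w = eval (unitCoord w) P * polyFun a Q w := by
  rw [polyFun, polyFun, map_mul]; ring

theorem unitCoord_smul {t : ℝ} (ht : 0 < t) (w : Ambient p q) : unitCoord (t • w) = unitCoord w := by
  funext k
  have : Sum.elim (t • w).1 (t • w).2 k = t * Sum.elim w.1 w.2 k := by
    rcases k with k | k <;> rfl
  rw [unitCoord, unitCoord, this, Prod.smul_fst, norm_smul, Real.norm_of_nonneg ht.le,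
    mul_div_mul_left _ _ ht.ne']

theorem unitCoord_neg (w : Ambient p q) (k) : unitCoord ((-1 : ℝ) • w) k = -unitCoord w k := by
  have : Sum.elim ((-1 : ℝ) • w).1 ((-1 : ℝ) • w).2 k = - Sum.elim w.1 w.2 k := by
    rcases k with k | k <;> simp
  rw [unitCoord, unitCoord, this, Prod.smul_fst, norm_smul]
  simp [neg_div]

theorem exp_mul_log {a : ℂ} {t : ℝ} (ht : 0 < t) :
    Complex.exp (a * Real.log t) = (t : ℂ) ^ a := by
  rw [Complex.cpow_def_of_ne_zero (by exact_mod_cast ht.ne'), Complex.ofReal_log ht.le, mul_comm]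

theorem polyMap_mem_homogeneous (a : ℂ) (P : Poly p q) : polyMap p q a P ∈ homogeneous p q a := by
  intro t ht w
  have hw : 0 < ‖w.1.1‖ := norm_pos_iff.2 (mem_neighborhood w.2).1
  change polyFun a P (t • w.1) = (t : ℂ) ^ a * polyFun a P w.1
  rw [polyFun, polyFun, unitCoord_smul ht, Prod.smul_fst, norm_smul, Real.norm_of_nonneg ht.le,
    Real.log_mul ht.ne' hw.ne', Complex.ofReal_add, mul_add, Complex.exp_add, exp_mul_log ht]
  ring

theorem eval_sqRadius_x {w : Ambient p q} (hw : w ∈ cone p q) :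
    eval (unitCoord w) (sqRadius (xVar p q)) = 1 := by
  have h := norm_ne_zero_iff.2 (mem_neighborhood hw).1
  have h' := EuclideanSpace.real_norm_sq_eq w.1
  simp only [sqRadius, map_sum, map_mul, eval_X, unitCoord, Sum.elim_inl]
  have : ∑ i, w.1 i / ‖w.1‖ * (w.1 i / ‖w.1‖) = 1 := by
    simp_rw [div_mul_div_comm, ← Finset.sum_div, ← sq]
    rw [← h', div_self (pow_ne_zero 2 h)]
  exact_mod_cast this

theorem eval_sqRadius_y {w : Ambient p q} (hw : w ∈ cone p q) :
    eval (unitCoord w) (sqRadius (yVar p q)) = 1 := by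
  have h := norm_ne_zero_iff.2 (mem_neighborhood hw).1
  have h' := EuclideanSpace.real_norm_sq_eq w.2
  simp only [sqRadius, map_sum, map_mul, eval_X, unitCoord, Sum.elim_inr]
  have : ∑ i, w.2 i / ‖w.1‖ * (w.2 i / ‖w.1‖) = 1 := by
    simp_rw [div_mul_div_comm, ← Finset.sum_div, ← sq]
    rw [← h', ← norm_fst_eq_norm_snd hw, div_self (pow_ne_zero 2 h)]
  exact_mod_cast this

/-- The relations `∑ x_i² = ∑ y_j² = 1` enter through this lemma: only the values on normalised
coordinates matter. -/
theorem polyMap_eq_of_eval_eq {a : ℂ} {P Q : Poly p q}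
    (h : ∀ w ∈ cone p q, eval (unitCoord w) P = eval (unitCoord w) Q) :
    polyMap p q a P = polyMap p q a Q :=
  Smooth.ext fun w => by
    rw [polyMap_apply, polyMap_apply, polyFun, polyFun, h w.1 w.2]

/-- Points that are related by a polynomial substitution `d` of the normalized coordinates. -/
theorem polyFun_aeval (a : ℂ) (P : Poly p q) {v w : Ambient p q} (hn : ‖v.1‖ = ‖w.1‖)
    {d : Fin p ⊕ Fin q → Poly p q} (hd : ∀ k, unitCoord v k = eval (unitCoord w) (d k)) :
    polyFun a P v = polyFun a (aeval d P) w := by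
  rw [polyFun, polyFun, hn, funext hd]
  congr 1
  have : (aeval fun k => eval (unitCoord w) (d k)) = (aeval (unitCoord w)).comp (aeval d) :=
    MvPolynomial.algHom_ext fun k => by simp
  have h := congrArg (fun f : Poly p q →ₐ[ℂ] ℂ => f P) this
  simpa [coe_aeval_eq_eval] using h

/-! ### Infinitesimal action on polynomial functions -/

theorem hasDerivAt_eval {σ : Type*} {z : ℝ → σ → ℂ} {t : ℝ} {δ : σ → MvPolynomial σ ℂ}
    (hz : ∀ k, HasDerivAt (fun s => z s k) (eval (z t) (δ k)) t) (P : MvPolynomial σ ℂ) :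
    HasDerivAt (fun s => eval (z s) P) (eval (z t) (mkDerivation ℂ δ P)) t := by
  induction P using MvPolynomial.induction_on with
  | C r => simpa using hasDerivAt_const t r
  | add P Q hP hQ =>
    simp only [map_add]
    exact hP.add hQ
  | mul_X P k hP =>
    have h := hP.mul (hz k)
    simp only [map_mul, eval_X, Derivation.leibniz, mkDerivation_X, smul_eq_mul, map_add]
    refine h.congr_deriv ?_
    ring

/-- Along `v` the logarithmic derivative of `|x|` is `b`. The factor `|x|^a` contributes `a b`, and
the quotient rule makes `d k - X k * b` the derivative of the normalised coordinate `k`. -/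
theorem hasDerivAt_polyFun (a : ℂ) (P : Poly p q) {γ : ℝ → Ambient p q} {v w : Ambient p q} {t : ℝ}
    (hγ : HasDerivAt γ v t) (hw : γ t = w) (hw₁ : w.1 ≠ 0) {d : Fin p ⊕ Fin q → Poly p q}
    {b : Poly p q} (hd : ∀ k, ((Sum.elim v.1 v.2 k / ‖w.1‖ : ℝ) : ℂ) = eval (unitCoord w) (d k))
    (hb : ((inner ℝ w.1 v.1 / ‖w.1‖ ^ 2 : ℝ) : ℂ) = eval (unitCoord w) b) :
    HasDerivAt (fun s => polyFun a P (γ s))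
      (polyFun a (a • (b * P) + mkDerivation ℂ (fun k => d k - X k * b) P) w) t := by
  have hr : ‖w.1‖ ≠ 0 := norm_ne_zero_iff.2 hw₁
  have h₁ : HasDerivAt (fun s => (γ s).1) v.1 t :=
    (ContinuousLinearMap.fst ℝ (EuclideanSpace ℝ (Fin p))
      (EuclideanSpace ℝ (Fin q))).hasFDerivAt.comp_hasDerivAt t hγ
  have h₂ : HasDerivAt (fun s => ‖(γ s).1‖) (inner ℝ w.1 v.1 / ‖w.1‖) t := by
    have h := h₁.norm_sq.sqrt (by rw [hw]; exact pow_ne_zero 2 hr)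
    simp only [Real.sqrt_sq (norm_nonneg _), hw] at h
    refine h.congr_deriv ?_
    field_simp
  have hc (k) : HasDerivAt (fun s => Sum.elim (γ s).1 (γ s).2 k) (Sum.elim v.1 v.2 k) t := by
    rcases k with i | i
    · exact ((EuclideanSpace.proj i : EuclideanSpace ℝ (Fin p) →L[ℝ] ℝ).comp
        (ContinuousLinearMap.fst ℝ _
          (EuclideanSpace ℝ (Fin q)))).hasFDerivAt.comp_hasDerivAt t hγ
    · exact ((EuclideanSpace.proj i : EuclideanSpace ℝ (Fin q) →L[ℝ] ℝ).comp
        (ContinuousLinearMap.snd ℝ (EuclideanSpace ℝ (Fin p))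
          _)).hasFDerivAt.comp_hasDerivAt t hγ
  have hz (k) : HasDerivAt (fun s => unitCoord (γ s) k)
      (eval (unitCoord (γ t)) (d k - X k * b)) t := by
    have h := ((hc k).div h₂ (by rw [hw]; exact hr)).ofReal_comp
    refine h.congr_deriv ?_
    rw [hw, map_sub, map_mul, ← hd, ← hb, eval_X, unitCoord]
    norm_cast
    field_simp
  have hE := hasDerivAt_eval hz P
  have hexp : HasDerivAt (fun s => Complex.exp (a * Real.log ‖(γ s).1‖))
      (Complex.exp (a * Real.log ‖w.1‖) * (a * eval (unitCoord w) b)) t := by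
    have h := ((h₂.log (by rw [hw]; exact hr)).ofReal_comp.const_mul a).cexp
    refine h.congr_deriv ?_
    rw [← hb, hw]
    congr 3
    rw [div_div, sq]
  refine (hexp.mul hE).congr_deriv ?_
  simp only [hw, polyFun, map_add, smul_eval, map_mul]
  ring

end LightCone

/-! ### Stability of closed invariant subspaces under rotations and boosts -/

namespace LightCone

open MeasureTheory Filter

variable {p q : ℕ}

open MvPolynomial

/-- Closed subspaces of `C^∞(X⁰)` that are invariant under `O(p,q)`. -/
structure IsClosedInvariant (W : Submodule ℂ (Smooth p q)) : Prop where
  isClosed : IsClosed (W : Set (Smooth p q))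
  rho_mem : ∀ g, ∀ f ∈ W, rho p q g f ∈ W

theorem IsClosedInvariant.mkDerivation_mem {W : Submodule ℂ (Smooth p q)}
    (hW : IsClosedInvariant W) {D : Ambient p q →L[ℝ] Ambient p q}
    (hD : ∀ u v, form (D u) v + form u (D v) = 0) {d : Fin p ⊕ Fin q → Poly p q} {b : Poly p q}
    (hd : ∀ w k, ((Sum.elim (D w).1 (D w).2 k / ‖w.1‖ : ℝ) : ℂ) = eval (unitCoord w) (d k))
    (hb : ∀ w, ((inner ℝ w.1 (D w).1 / ‖w.1‖ ^ 2 : ℝ) : ℂ) = eval (unitCoord w) b)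
    (a : ℂ) {P : Poly p q} (hP : polyMap p q a P ∈ W) :
    polyMap p q a (a • (b * P) + mkDerivation ℂ (fun k => d k - X k * b) P) ∈ W := by
  refine generator_mem hD hW.isClosed hW.rho_mem hP fun w => ?_
  have h := hasDerivAt_flow_apply D w.1 0
  rw [flow_zero_apply] at h
  exact hasDerivAt_polyFun a P h (flow_zero_apply D w.1) (mem_neighborhood w.2).1 (hd w.1) (hb w.1)

/-- The coordinate functional `x_i`. -/
noncomputable def xCoord (i : Fin p) : Ambient p q →L[ℝ] ℝ :=
  (EuclideanSpace.proj i : EuclideanSpace ℝ (Fin p) →L[ℝ] ℝ).comp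
    (ContinuousLinearMap.fst ℝ _ (EuclideanSpace ℝ (Fin q)))

/-- The coordinate functional `y_j`. -/
noncomputable def yCoord (j : Fin q) : Ambient p q →L[ℝ] ℝ :=
  (EuclideanSpace.proj j : EuclideanSpace ℝ (Fin q) →L[ℝ] ℝ).comp
    (ContinuousLinearMap.snd ℝ (EuclideanSpace ℝ (Fin p)) _)

theorem unitCoord_inl (w : Ambient p q) (i : Fin p) :
    unitCoord w (Sum.inl i) = ((w.1 i / ‖w.1‖ : ℝ) : ℂ) := rfl

theorem unitCoord_inr (w : Ambient p q) (j : Fin q) :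
    unitCoord w (Sum.inr j) = ((w.2 j / ‖w.1‖ : ℝ) : ℂ) := rfl

theorem form_eq_inner (v w : Ambient p q) : form v w = inner ℝ v.1 w.1 - inner ℝ v.2 w.2 := by
  simp [form, PiLp.inner_apply, mul_comm]

theorem IsClosedInvariant.rot_x_mem {W : Submodule ℂ (Smooth p q)} (hW : IsClosedInvariant W)
    (a : ℂ) (i j : Fin p) {P : Poly p q} (hP : polyMap p q a P ∈ W) :
    polyMap p q a (rot (xVar p q) i j P) ∈ W := by
  let D : Ambient p q →L[ℝ] Ambient p q :=
    (xCoord i).smulRight (EuclideanSpace.single j 1, 0) -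
      (xCoord j).smulRight (EuclideanSpace.single i 1, 0)
  have hDa (w : Ambient p q) : D w =
      (w.1 i • EuclideanSpace.single j 1 - w.1 j • EuclideanSpace.single i 1, 0) := by
    ext k <;> simp [D, xCoord]
  -- Here `b = 0` because a rotation preserves `|x|`; the degree `a` therefore drops out.
  have h := hW.mkDerivation_mem (D := D) (d := fun k => rot (xVar p q) i j (X k)) (b := 0)
    (fun u v => by
      simp only [form_eq_inner, hDa, inner_sub_left, inner_sub_right, inner_smul_left,
        inner_smul_right, EuclideanSpace.inner_single_left, EuclideanSpace.inner_single_right,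
        inner_zero_left, inner_zero_right]
      simp
      ring)
    (fun w k => by
      rcases k with k | k
      · simp only [hDa, Sum.elim_inl, rot_apply, pderiv_X, Pi.single_apply, map_sub, map_mul,
          eval_X, unitCoord_inl]
        by_cases h₁ : k = j <;> by_cases h₂ : k = i <;>
          simp [h₁, h₂, sub_div, eq_comm] <;> split_ifs <;> simp_all
      · simp [hDa, rot_apply])
    (fun w => by
      simp only [hDa, inner_sub_right, inner_smul_right, EuclideanSpace.inner_single_right]
      simp
      left; ring) a hP
  convert h using 2
  simp only [zero_mul, smul_zero, zero_add, mul_zero, sub_zero]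
  exact congrArg (fun D : Derivation ℂ (Poly p q) (Poly p q) => D P)
    (MvPolynomial.derivation_ext fun k => by rw [mkDerivation_X])

theorem IsClosedInvariant.rot_y_mem {W : Submodule ℂ (Smooth p q)} (hW : IsClosedInvariant W)
    (a : ℂ) (i j : Fin q) {P : Poly p q} (hP : polyMap p q a P ∈ W) :
    polyMap p q a (rot (yVar p q) i j P) ∈ W := by
  let D : Ambient p q →L[ℝ] Ambient p q :=
    (yCoord i).smulRight (0, EuclideanSpace.single j 1) -
      (yCoord j).smulRight (0, EuclideanSpace.single i 1)
  have hDa (w : Ambient p q) : D w =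
      (0, w.2 i • EuclideanSpace.single j 1 - w.2 j • EuclideanSpace.single i 1) := by
    ext k <;> simp [D, yCoord]
  have h := hW.mkDerivation_mem (D := D) (d := fun k => rot (yVar p q) i j (X k)) (b := 0)
    (fun u v => by
      simp only [form_eq_inner, hDa, inner_sub_left, inner_sub_right, inner_smul_left,
        inner_smul_right, EuclideanSpace.inner_single_left, EuclideanSpace.inner_single_right,
        inner_zero_left, inner_zero_right]
      simp
      ring)
    (fun w k => by
      rcases k with k | k
      · simp [hDa, rot_apply]
      · simp only [hDa, Sum.elim_inr, rot_apply, pderiv_X, Pi.single_apply, map_sub, map_mul,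
          eval_X, unitCoord_inr]
        by_cases h₁ : k = j <;> by_cases h₂ : k = i <;>
          simp [h₁, h₂, sub_div, eq_comm] <;> split_ifs <;> simp_all)
    (fun w => by simp [hDa]) a hP
  convert h using 2
  simp only [zero_mul, smul_zero, zero_add, mul_zero, sub_zero]
  exact congrArg (fun D : Derivation ℂ (Poly p q) (Poly p q) => D P)
    (MvPolynomial.derivation_ext fun k => by rw [mkDerivation_X])

theorem IsClosedInvariant.boost_mem {W : Submodule ℂ (Smooth p q)} (hW : IsClosedInvariant W)
    (a : ℂ) (i : Fin p) (j : Fin q) {P : Poly p q} (hP : polyMap p q a P ∈ W) :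
    polyMap p q a (boost a i j P) ∈ W := by
  let D : Ambient p q →L[ℝ] Ambient p q :=
    (yCoord j).smulRight (EuclideanSpace.single i 1, 0) +
      (xCoord i).smulRight (0, EuclideanSpace.single j 1)
  have hDa (w : Ambient p q) : D w =
      (w.2 j • EuclideanSpace.single i 1, w.1 i • EuclideanSpace.single j 1) := by
    ext k <;> simp [D, xCoord, yCoord]
  let B : Derivation ℂ (Poly p q) (Poly p q) :=
    (X (yVar p q j) : Poly p q) • pderiv (xVar p q i) +
      (X (xVar p q i) : Poly p q) • pderiv (yVar p q j)
  have h := hW.mkDerivation_mem (D := D) (d := fun k => B (X k))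
    (b := X (xVar p q i) * X (yVar p q j))
    (fun u v => by
      simp only [form_eq_inner, hDa, inner_smul_left,
        inner_smul_right, EuclideanSpace.inner_single_left, EuclideanSpace.inner_single_right]
      simp
      ring)
    (fun w k => by
      rcases k with k | k
      · by_cases h : k = i <;> simp [B, hDa, pderiv_X, unitCoord_inr, h]
      · by_cases h : k = j <;> simp [B, hDa, pderiv_X, unitCoord_inl, h])
    (fun w => by
      simp only [hDa, inner_smul_right, EuclideanSpace.inner_single_right, map_mul, eval_X,
        unitCoord_inl, unitCoord_inr]
      norm_cast
      simp
      ring) a hP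
  convert h using 2
  -- Subtracting `X k * b` from every coordinate derivative amounts to subtracting `b` times the
  -- total Euler operator.
  have hB : mkDerivation ℂ (fun k => B (X k) - X k * (X (xVar p q i) * X (yVar p q j))) =
      B - (X (xVar p q i) * X (yVar p q j) : Poly p q) • (euler (xVar p q) + euler (yVar p q)) := by
    refine MvPolynomial.derivation_ext fun k => ?_
    have hE : (euler (xVar p q) + euler (yVar p q) : Derivation ℂ (Poly p q) (Poly p q)) (X k) =
        euler (xVar p q) (X k) + euler (yVar p q) (X k) := rfl
    rw [mkDerivation_X, Derivation.sub_apply, Derivation.smul_apply, hE, euler_apply, euler_apply]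
    refine congrArg _ ?_
    rcases k with k | k
    · simp [pderiv_X, Pi.single_apply]
      ring
    · simp [pderiv_X, Pi.single_apply]
      ring
  rw [hB]
  simp only [B, boost, Derivation.sub_apply, Derivation.smul_apply, Derivation.add_apply,
    smul_eq_mul, mul_assoc]
  abel

end LightCone

namespace LightCone

open MeasureTheory Filter

variable {p q : ℕ}

/-! ### The maximal compact subgroup -/

/-- The compact group `O(p) × O(q)`. -/
def CompactGroup (p q : ℕ) : Type :=
  Matrix.orthogonalGroup (Fin p) ℝ × Matrix.orthogonalGroup (Fin q) ℝ

namespace CompactGroup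

/-- The pair of two orthogonal matrices. -/
def mk (A : Matrix.orthogonalGroup (Fin p) ℝ) (B : Matrix.orthogonalGroup (Fin q) ℝ) :
    CompactGroup p q := (A, B)

noncomputable instance : Group (CompactGroup p q) :=
  inferInstanceAs (Group (Matrix.orthogonalGroup (Fin p) ℝ × Matrix.orthogonalGroup (Fin q) ℝ))

instance : TopologicalSpace (CompactGroup p q) :=
  inferInstanceAs (TopologicalSpace
    (Matrix.orthogonalGroup (Fin p) ℝ × Matrix.orthogonalGroup (Fin q) ℝ))

instance : IsTopologicalGroup (CompactGroup p q) :=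
  inferInstanceAs (IsTopologicalGroup
    (Matrix.orthogonalGroup (Fin p) ℝ × Matrix.orthogonalGroup (Fin q) ℝ))

instance : TopologicalSpace.MetrizableSpace (CompactGroup p q) := by
  have h (n : ℕ) : TopologicalSpace.MetrizableSpace (Matrix (Fin n) (Fin n) ℝ) :=
    inferInstanceAs (TopologicalSpace.MetrizableSpace (Fin n → Fin n → ℝ))
  have h' (n : ℕ) : TopologicalSpace.MetrizableSpace (Matrix.orthogonalGroup (Fin n) ℝ) :=
    Topology.IsEmbedding.subtypeVal.metrizableSpace
  exact inferInstanceAs (TopologicalSpace.MetrizableSpace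
    (Matrix.orthogonalGroup (Fin p) ℝ × Matrix.orthogonalGroup (Fin q) ℝ))

instance : SecondCountableTopology (CompactGroup p q) := by
  have h (n : ℕ) : SecondCountableTopology (Matrix (Fin n) (Fin n) ℝ) :=
    inferInstanceAs (SecondCountableTopology (Fin n → Fin n → ℝ))
  have h' (n : ℕ) : SecondCountableTopology (Matrix.orthogonalGroup (Fin n) ℝ) :=
    Topology.IsEmbedding.subtypeVal.secondCountableTopology
  exact inferInstanceAs (SecondCountableTopology
    (Matrix.orthogonalGroup (Fin p) ℝ × Matrix.orthogonalGroup (Fin q) ℝ))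

theorem isCompact_orthogonalGroup (n : ℕ) :
    IsCompact (Matrix.orthogonalGroup (Fin n) ℝ : Set (Matrix (Fin n) (Fin n) ℝ)) := by
  have h : IsCompact ({A : Matrix (Fin n) (Fin n) ℝ | ∀ i ∈ univ, A i ∈
      {v : Fin n → ℝ | ∀ j ∈ univ, v j ∈ Icc (-1 : ℝ) 1}}) :=
    isCompact_univ_pi fun _ => isCompact_univ_pi fun _ => isCompact_Icc
  refine h.of_isClosed_subset ?_ fun A hA i _ j _ => ?_
  · have : (Matrix.orthogonalGroup (Fin n) ℝ : Set (Matrix (Fin n) (Fin n) ℝ)) =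
        {A | A * A.transpose = 1} := by
      ext A
      exact Matrix.mem_orthogonalGroup_iff _ _
    rw [this]
    exact isClosed_eq (by fun_prop) continuous_const
  · have := entry_norm_bound_of_unitary hA i j
    rw [Real.norm_eq_abs, abs_le] at this
    exact this

instance : CompactSpace (CompactGroup p q) := by
  have h (n : ℕ) : CompactSpace (Matrix.orthogonalGroup (Fin n) ℝ) :=
    isCompact_iff_compactSpace.1 (isCompact_orthogonalGroup n)
  exact inferInstanceAs (CompactSpace
    (Matrix.orthogonalGroup (Fin p) ℝ × Matrix.orthogonalGroup (Fin q) ℝ))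

instance : MeasurableSpace (CompactGroup p q) := borel _

instance : BorelSpace (CompactGroup p q) := ⟨rfl⟩

/-- A Haar measure of `O(p) × O(q)`. -/
noncomputable def haar (p q : ℕ) : Measure (CompactGroup p q) := Measure.haar

instance : IsFiniteMeasure (haar p q) :=
  inferInstanceAs (IsFiniteMeasure (Measure.haar : Measure (CompactGroup p q)))

instance : (haar p q).IsOpenPosMeasure :=
  inferInstanceAs (Measure.IsOpenPosMeasure (Measure.haar : Measure (CompactGroup p q)))

instance : (haar p q).IsMulLeftInvariant :=
  inferInstanceAs (Measure.IsMulLeftInvariant (Measure.haar : Measure (CompactGroup p q)))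

/-- The linear action of `O(p) × O(q)` on `ℝ^{p+q}`. -/
noncomputable def act (p q : ℕ) : CompactGroup p q →* (Ambient p q →L[ℝ] Ambient p q) where
  toFun k := (Matrix.toEuclideanCLM (𝕜 := ℝ) k.1.1).prodMap (Matrix.toEuclideanCLM (𝕜 := ℝ) k.2.1)
  map_one' := by
    have h₁ : ((1 : CompactGroup p q).1.1 : Matrix _ _ ℝ) = 1 := rfl
    have h₂ : ((1 : CompactGroup p q).2.1 : Matrix _ _ ℝ) = 1 := rfl
    rw [h₁, h₂, map_one, map_one]
    rfl
  map_mul' k l := by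
    have h₁ : ((k * l).1.1 : Matrix _ _ ℝ) = k.1.1 * l.1.1 := rfl
    have h₂ : ((k * l).2.1 : Matrix _ _ ℝ) = k.2.1 * l.2.1 := rfl
    rw [h₁, h₂, map_mul, map_mul]
    rfl

theorem act_fst (k : CompactGroup p q) (w : Ambient p q) (i : Fin p) :
    (act p q k w).1 i = ∑ j, k.1.1 i j * w.1 j := rfl

theorem act_snd (k : CompactGroup p q) (w : Ambient p q) (i : Fin q) :
    (act p q k w).2 i = ∑ j, k.2.1 i j * w.2 j := rfl

theorem continuous_act : Continuous (act p q) := by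
  have h (n : ℕ) : Continuous (Matrix.toEuclideanCLM (n := Fin n) (𝕜 := ℝ)) := by
    let T : Matrix (Fin n) (Fin n) ℝ →ₗ[ℝ] EuclideanSpace ℝ (Fin n) →L[ℝ] EuclideanSpace ℝ (Fin n) :=
      { toFun := Matrix.toEuclideanCLM (n := Fin n) (𝕜 := ℝ)
        map_add' := map_add _
        map_smul' := map_smul _ }
    exact T.continuous_of_finiteDimensional
  have h₁ : Continuous fun k : CompactGroup p q => (k.1.1 : Matrix _ _ ℝ) :=
    continuous_subtype_val.comp (continuous_fst
      (X := Matrix.orthogonalGroup (Fin p) ℝ) (Y := Matrix.orthogonalGroup (Fin q) ℝ))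
  have h₂ : Continuous fun k : CompactGroup p q => (k.2.1 : Matrix _ _ ℝ) :=
    continuous_subtype_val.comp (continuous_snd
      (X := Matrix.orthogonalGroup (Fin p) ℝ) (Y := Matrix.orthogonalGroup (Fin q) ℝ))
  exact ((h p).comp h₁).prod_mapL ℝ ((h q).comp h₂)

theorem inner_toEuclideanCLM_toEuclideanCLM {n : ℕ} (A : Matrix.orthogonalGroup (Fin n) ℝ)
    (x y : EuclideanSpace ℝ (Fin n)) :
    inner ℝ (Matrix.toEuclideanCLM (𝕜 := ℝ) A.1 x) (Matrix.toEuclideanCLM (𝕜 := ℝ) A.1 y) =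
      inner ℝ x y := by
  have h := (Matrix.mem_orthogonalGroup_iff' _ _).1 A.2
  rw [← ContinuousLinearMap.adjoint_inner_right, ← ContinuousLinearMap.star_eq_adjoint, ← map_star]
  rw [← mul_apply_eq_comp, ← map_mul, Matrix.star_eq_conjTranspose,
    Matrix.conjTranspose_eq_transpose_of_trivial]
  rw [h, map_one]
  rfl

theorem norm_act_fst (k : CompactGroup p q) (w : Ambient p q) : ‖(act p q k w).1‖ = ‖w.1‖ := by
  rw [@norm_eq_sqrt_real_inner, @norm_eq_sqrt_real_inner _ _ _ w.1]
  exact congrArg _ (inner_toEuclideanCLM_toEuclideanCLM k.1 w.1 w.1)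

theorem act_inv_act (k : CompactGroup p q) (w : Ambient p q) : act p q k⁻¹ (act p q k w) = w := by
  rw [← mul_apply_eq_comp, ← map_mul, inv_mul_cancel, map_one]; rfl

theorem act_act_inv (k : CompactGroup p q) (w : Ambient p q) : act p q k (act p q k⁻¹ w) = w := by
  rw [← mul_apply_eq_comp, ← map_mul, mul_inv_cancel, map_one]; rfl

/-- The inclusion of `O(p) × O(q)` in `O(p,q)`. -/
noncomputable def incl (p q : ℕ) : CompactGroup p q →* indefiniteOrthogonalGroup p q where
  toFun k := ⟨LinearEquiv.ofLinearMap (act p q k) (act p q k⁻¹)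
    (LinearMap.ext (act_act_inv k)) (LinearMap.ext (act_inv_act k)), fun w w' => by
      rw [form_eq_inner, form_eq_inner]
      exact congrArg₂ (· - ·) (inner_toEuclideanCLM_toEuclideanCLM k.1 w.1 w'.1)
        (inner_toEuclideanCLM_toEuclideanCLM k.2 w.2 w'.2)⟩
  map_one' := Subtype.ext (LinearEquiv.ext fun w => by
    change act p q 1 w = w
    rw [map_one]; rfl)
  map_mul' k l := Subtype.ext (LinearEquiv.ext fun w => by
    change act p q (k * l) w = act p q k (act p q l w)
    rw [map_mul]; rfl)

theorem jetContinuous (f : Smooth p q) :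
    JetContinuous fun k : CompactGroup p q => rho p q (incl p q k) f :=
  jetContinuous_rho (ι := fun k => act p q k⁻¹) (continuous_act.comp continuous_inv)
    (fun _ _ => rfl) f

/-- The entries of the two matrices that make up an element of `O(p) × O(q)`. -/
def entry (k : CompactGroup p q) : (Fin p × Fin p) ⊕ (Fin q × Fin q) → ℝ :=
  Sum.elim (fun t => k.1.1 t.1 t.2) (fun t => k.2.1 t.1 t.2)

theorem continuous_entry (t) : Continuous fun k : CompactGroup p q => entry k t := by
  have h₁ : Continuous fun k : CompactGroup p q => (k.1.1 : Matrix _ _ ℝ) :=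
    continuous_subtype_val.comp (continuous_fst
      (X := Matrix.orthogonalGroup (Fin p) ℝ) (Y := Matrix.orthogonalGroup (Fin q) ℝ))
  have h₂ : Continuous fun k : CompactGroup p q => (k.2.1 : Matrix _ _ ℝ) :=
    continuous_subtype_val.comp (continuous_snd
      (X := Matrix.orthogonalGroup (Fin p) ℝ) (Y := Matrix.orthogonalGroup (Fin q) ℝ))
  rcases t with t | t
  · exact h₁.matrix_elem t.1 t.2
  · exact h₂.matrix_elem t.1 t.2

theorem entry_injective : Function.Injective (entry (p := p) (q := q)) := by
  intro k l h
  refine Prod.ext (Subtype.ext (Matrix.ext fun i j => ?_)) (Subtype.ext (Matrix.ext fun i j => ?_))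
  · exact congrFun h (Sum.inl (i, j))
  · exact congrFun h (Sum.inr (i, j))

end CompactGroup

end LightCone

/-! ### `O(p) × O(q)` on polynomials, and even polynomials as multipliers -/

namespace LightCone

open MeasureTheory Filter

variable {p q : ℕ}

open MvPolynomial

namespace CompactGroup

/-- The linear substitution by which an element of `O(p) × O(q)` acts on polynomials. -/
noncomputable def subst (k : CompactGroup p q) : Fin p ⊕ Fin q → Poly p q :=
  Sum.elim (fun i => ∑ j, C ((k.1.1 i j : ℝ) : ℂ) * X (xVar p q j))
    (fun i => ∑ j, C ((k.2.1 i j : ℝ) : ℂ) * X (yVar p q j))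

theorem unitCoord_act (k : CompactGroup p q) (w : Ambient p q) (l : Fin p ⊕ Fin q) :
    unitCoord (act p q k w) l = eval (unitCoord w) (subst k l) := by
  rcases l with i | i
  · rw [unitCoord_inl, norm_act_fst, act_fst, subst, Sum.elim_inl, map_sum, Finset.sum_div,
      Complex.ofReal_sum]
    refine Finset.sum_congr rfl fun j _ => ?_
    rw [map_mul, eval_C, eval_X, unitCoord_inl, mul_div_assoc, Complex.ofReal_mul]
  · rw [unitCoord_inr, norm_act_fst, act_snd, subst, Sum.elim_inr, map_sum, Finset.sum_div,
      Complex.ofReal_sum]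
    refine Finset.sum_congr rfl fun j _ => ?_
    rw [map_mul, eval_C, eval_X, unitCoord_inr, mul_div_assoc, Complex.ofReal_mul]

theorem rho_incl_polyMap (a : ℂ) (k : CompactGroup p q) (P : Poly p q) :
    rho p q (incl p q k) (polyMap p q a P) = polyMap p q a (aeval (subst k⁻¹) P) :=
  Smooth.ext fun w =>
    polyFun_aeval a P (norm_act_fst k⁻¹ w.1) fun l => unitCoord_act k⁻¹ w.1 l

/-- A scalar `±1` in an orthogonal group. -/
def sign (n m : ℕ) : Matrix.orthogonalGroup (Fin n) ℝ :=
  ⟨(-1) ^ m, pow_mem ((Matrix.mem_orthogonalGroup_iff _ _).2 (by simp)) m⟩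

/-- The twist comes from the pair of scalar matrices `(-1)^(p+1)` and `(-1)^(q+1)`, so invariant
subspaces are stable under it. -/
theorem exists_subst_eq_twistSign :
    ∃ k : CompactGroup p q, ∀ l, subst k⁻¹ l = C (twistSign p q l) * X l := by
  refine ⟨(mk (sign p (p + 1)) (sign q (q + 1)))⁻¹, fun l => ?_⟩
  rw [inv_inv]
  have h (n m : ℕ) (i j : Fin n) : (sign n m).1 i j = if i = j then (-1) ^ m else 0 := by
    have : (sign n m).1 = Matrix.diagonal fun _ => (-1) ^ m := by
      change (-1 : Matrix (Fin n) (Fin n) ℝ) ^ m = _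
      rw [← Matrix.diagonal_one, Matrix.diagonal_neg, Matrix.diagonal_pow]
      rfl
    rw [this, Matrix.diagonal_apply]
  rcases l with i | i
  · change ∑ j, C (((sign p (p + 1)).1 i j : ℝ) : ℂ) * X (xVar p q j) = _
    rw [Finset.sum_eq_single i (fun j _ hj => by rw [h, if_neg hj.symm]; simp) (by simp), h,
      if_pos rfl]
    simp [twistSign, xVar]
  · change ∑ j, C (((sign q (q + 1)).1 i j : ℝ) : ℂ) * X (yVar p q j) = _
    rw [Finset.sum_eq_single i (fun j _ hj => by rw [h, if_neg hj.symm]; simp) (by simp), h,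
      if_pos rfl]
    simp [twistSign, yVar]

end CompactGroup

theorem polyMap_eq_zero {a : ℂ} {P : Poly p q} (h : ∀ w ∈ cone p q, eval (unitCoord w) P = 0) :
    polyMap p q a P = 0 := by
  rw [← map_zero (polyMap p q a)]
  exact polyMap_eq_of_eval_eq fun w hw => by rw [h w hw, map_zero]

theorem IsClosedInvariant.isBoostStable {W : Submodule ℂ (Smooth p q)} (hW : IsClosedInvariant W)
    (a : ℂ) : IsBoostStable a (W.comap (polyMap p q a)) where
  rot_x_mem i j _ hP := hW.rot_x_mem a i j hP
  rot_y_mem i j _ hP := hW.rot_y_mem a i j hP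
  boost_mem i j _ hP := hW.boost_mem a i j hP
  twist_mem P hP := by
    obtain ⟨k, hk⟩ := CompactGroup.exists_subst_eq_twistSign (p := p) (q := q)
    have h := hW.rho_mem (CompactGroup.incl p q k) _ hP
    rw [CompactGroup.rho_incl_polyMap, funext hk] at h
    exact h
  sphere_x_mem P := by
    rw [Submodule.mem_comap, polyMap_eq_zero fun w hw => by
      rw [map_mul, map_sub, eval_sqRadius_x hw, map_one, sub_self, zero_mul]]
    exact W.zero_mem
  sphere_y_mem P := by
    rw [Submodule.mem_comap, polyMap_eq_zero fun w hw => by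
      rw [map_mul, map_sub, eval_sqRadius_y hw, map_one, sub_self, zero_mul]]
    exact W.zero_mem

/-- Products within one block reduce to mixed ones: on the cone, in normalised coordinates, `x_k x_l
= ∑_j (x_k y_j)(x_l y_j)`, and likewise for two `y` variables. -/
theorem IsClosedInvariant.X_mul_X_mul_mem {W : Submodule ℂ (Smooth p q)}
    (hW : IsClosedInvariant W) {a : ℂ} (ha : ∀ n : ℤ, a ≠ n) (k l : Fin p ⊕ Fin q) {P : Poly p q}
    (hP : polyMap p q a P ∈ W) : polyMap p q a (X k * (X l * P)) ∈ W := by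
  have h (i j) {P : Poly p q} (hP : polyMap p q a P ∈ W) :
      polyMap p q a (X (xVar p q i) * (X (yVar p q j) * P)) ∈ W :=
    (hW.isBoostStable a).mul_mem ha i j hP
  rcases k with k | k <;> rcases l with l | l
  · rw [polyMap_eq_of_eval_eq (Q := ∑ j, X (xVar p q k) * (X (yVar p q j) *
      (X (xVar p q l) * (X (yVar p q j) * P)))) fun w hw => ?_, map_sum]
    · exact W.sum_mem fun j _ => h k j (h l j hP)
    · rw [← one_mul (eval _ _), ← eval_sqRadius_y hw, sqRadius, ← map_mul, Finset.sum_mul]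
      refine congrArg _ (Finset.sum_congr rfl fun j _ => ?_)
      simp only [xVar]
      ring
  · exact h k l hP
  · rw [mul_left_comm]
    exact h l k hP
  · rw [polyMap_eq_of_eval_eq (Q := ∑ i, X (xVar p q i) * (X (yVar p q k) *
      (X (xVar p q i) * (X (yVar p q l) * P)))) fun w hw => ?_, map_sum]
    · exact W.sum_mem fun i _ => h i k (h i l hP)
    · rw [← one_mul (eval _ _), ← eval_sqRadius_x hw, sqRadius, ← map_mul, Finset.sum_mul]
      refine congrArg _ (Finset.sum_congr rfl fun j _ => ?_)
      simp only [yVar]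
      ring

/-- The substitution `w ↦ -w` on polynomials. -/
noncomputable def reflect (p q : ℕ) : Poly p q →ₐ[ℂ] Poly p q := aeval fun k => -X k

theorem eval_reflect (z : Fin p ⊕ Fin q → ℂ) (P : Poly p q) :
    eval z (reflect p q P) = eval (-z) P := by
  induction P using MvPolynomial.induction_on with
  | C r => simp [reflect]
  | add P Q hP hQ => simp [hP, hQ]
  | mul_X P k hP => rw [map_mul, map_mul, hP]; simp [reflect]

/-- The even part of `Q` and a variable times its odd part have to be treated together: multiplying
`Q` by a variable exchanges the two claims. -/
theorem IsClosedInvariant.add_reflect_mul_mem {W : Submodule ℂ (Smooth p q)}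
    (hW : IsClosedInvariant W) {a : ℂ} (ha : ∀ n : ℤ, a ≠ n) (Q : Poly p q) :
    (∀ P, polyMap p q a P ∈ W → polyMap p q a ((Q + reflect p q Q) * P) ∈ W) ∧
      ∀ k P, polyMap p q a P ∈ W → polyMap p q a (X k * ((Q - reflect p q Q) * P)) ∈ W := by
  have hX (k) : reflect p q (X k) = -X k := by simp [reflect]
  induction Q using MvPolynomial.induction_on with
  | C r =>
    have hr : reflect p q (C r) = C r := by simp [reflect]
    refine ⟨fun P hP => ?_, fun k P _ => ?_⟩
    · rw [hr, ← C_add, C_mul', map_smul]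
      exact W.smul_mem _ hP
    · rw [hr, sub_self, zero_mul, mul_zero, map_zero]
      exact W.zero_mem
  | add Q R hQ hR =>
    refine ⟨fun P hP => ?_, fun k P hP => ?_⟩
    · rw [map_add, add_add_add_comm, add_mul, map_add]
      exact W.add_mem (hQ.1 P hP) (hR.1 P hP)
    · rw [map_add, add_sub_add_comm, add_mul, mul_add, map_add]
      exact W.add_mem (hQ.2 k P hP) (hR.2 k P hP)
  | mul_X Q l hQ =>
    refine ⟨fun P hP => ?_, fun k P hP => ?_⟩
    · convert hQ.2 l P hP using 2
      rw [map_mul, hX]; ring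
    · convert hW.X_mul_X_mul_mem ha k l (hQ.1 P hP) using 2
      rw [map_mul, hX]; ring

/-- Polynomials that are even on the cone multiply closed invariant subspaces to themselves. -/
theorem IsClosedInvariant.even_mul_mem {W : Submodule ℂ (Smooth p q)}
    (hW : IsClosedInvariant W) {a : ℂ} (ha : ∀ n : ℤ, a ≠ n) {P Q : Poly p q}
    (hP : polyMap p q a P ∈ W)
    (hQ : ∀ w ∈ cone p q, eval (-unitCoord w) Q = eval (unitCoord w) Q) :
    polyMap p q a (Q * P) ∈ W := by
  have h := W.smul_mem (2⁻¹ : ℂ) ((hW.add_reflect_mul_mem ha Q).1 P hP)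
  rw [← map_smul] at h
  rwa [polyMap_eq_of_eval_eq fun w hw => ?_]
  rw [smul_eval, map_mul (eval _) (Q + _), map_add, eval_reflect, hQ w hw, map_mul]
  ring

end LightCone

namespace LightCone

open MeasureTheory Filter

variable {p q : ℕ}

open MvPolynomial

/-! ### Functions that are polynomial in group coordinates -/

/-- Clearing denominators after the substitution `z = N / D`; the exponent and the polynomial do not
depend on the point. -/
theorem exists_pow_mul_eval {σ τ : Type*} (D : MvPolynomial σ ℂ) (N : τ → MvPolynomial σ ℂ)
    (Φ : MvPolynomial τ ℂ) : ∃ (n : ℕ) (P : MvPolynomial σ ℂ), ∀ (u : σ → ℂ) (z : τ → ℂ),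
      (∀ t, eval u D * z t = eval u (N t)) → eval u D ^ n * eval z Φ = eval u P := by
  induction Φ using MvPolynomial.induction_on with
  | C r => exact ⟨0, C r, fun u z _ => by simp⟩
  | add Φ Ψ h₁ h₂ =>
    obtain ⟨n, P, hP⟩ := h₁
    obtain ⟨m, Q, hQ⟩ := h₂
    refine ⟨n + m, D ^ m * P + D ^ n * Q, fun u z h => ?_⟩
    rw [map_add, map_add, map_mul, map_mul, ← hP u z h, ← hQ u z h, map_pow, map_pow]
    ring
  | mul_X Φ t h₁ =>
    obtain ⟨n, P, hP⟩ := h₁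
    refine ⟨n + 1, P * N t, fun u z h => ?_⟩
    rw [map_mul, map_mul, ← hP u z h, ← h t, eval_X]
    ring

/-- The polynomials that multiply a given function on the cone to a polynomial. -/
noncomputable def denominators (F : cone p q → ℂ) : Ideal (Poly p q) where
  carrier := {Q | ∃ P, ∀ w : cone p q, eval (unitCoord w.1) Q * F w = eval (unitCoord w.1) P}
  zero_mem' := ⟨0, fun w => by simp⟩
  add_mem' := by
    rintro Q R ⟨P, hP⟩ ⟨S, hS⟩
    exact ⟨P + S, fun w => by rw [map_add, add_mul, hP, hS, map_add]⟩
  smul_mem' := by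
    rintro R Q ⟨P, hP⟩
    exact ⟨R * P, fun w => by rw [smul_eq_mul, map_mul, mul_assoc, hP, map_mul]⟩

/-! ### Sections of the action of `O(p) × O(q)` -/

/-- For `v = x - s e_0` one has `|v|² = 2 (1 - s x_0)`, and the reflection in the hyperplane
orthogonal to `v` exchanges `x` and `s e_0`. Its product with `s` sends `e_0` to `x` and has entries
rational in `x` with denominator `1 - s x_0`. -/
theorem exists_orthogonal_apply_single {n : ℕ} [NeZero n] {x : EuclideanSpace ℝ (Fin n)}
    (hx : ‖x‖ = 1) {s : ℝ} (hs : s * s = 1) (h : 1 - s * x 0 ≠ 0) :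
    ∃ A : Matrix.orthogonalGroup (Fin n) ℝ,
      Matrix.toEuclideanCLM (𝕜 := ℝ) A.1 (EuclideanSpace.single 0 1) = x ∧
      ∀ i j, (1 - s * x 0) * A.1 i j = s * ((1 - s * x 0) * (if i = j then 1 else 0) -
        (x i - s * (if i = 0 then 1 else 0)) * (x j - s * (if j = 0 then 1 else 0))) := by
  set v : Fin n → ℝ := fun i => x i - s * (if i = 0 then 1 else 0) with hv
  set c := 1 - s * x 0 with hc
  have hx2 : ∑ i, x i * x i = 1 := by
    have := EuclideanSpace.real_norm_sq_eq x
    rw [hx] at this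
    simpa [sq] using this.symm
  have hvv : v ⬝ᵥ v = 2 * c := by
    simp only [dotProduct, hv]
    have : ∀ i, (x i - s * (if i = 0 then 1 else 0)) * (x i - s * (if i = 0 then 1 else 0)) =
        x i * x i - (if i = 0 then 2 * s * x i - s * s else 0) := by
      intro i
      split_ifs <;> ring
    simp_rw [this]
    rw [Finset.sum_sub_distrib, hx2, Finset.sum_ite_eq' Finset.univ (0 : Fin n),
      if_pos (Finset.mem_univ _), hs, hc]
    ring
  set A : Matrix (Fin n) (Fin n) ℝ := s • (1 - c⁻¹ • Matrix.vecMulVec v v) with hA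
  have hAij (i j) : A i j = s * ((if i = j then 1 else 0) - c⁻¹ * (v i * v j)) := by
    simp [hA, Matrix.vecMulVec_apply, Matrix.one_apply]
  refine ⟨⟨A, (Matrix.mem_orthogonalGroup_iff _ _).2 ?_⟩, ?_, fun i j => ?_⟩
  · have h2 : Matrix.vecMulVec v v * Matrix.vecMulVec v v = (2 * c) • Matrix.vecMulVec v v := by
      rw [Matrix.vecMulVec_mul_vecMulVec, hvv, Matrix.vecMulVec_smul]
    have hT : A.transpose = A := by
      ext i j
      rw [Matrix.transpose_apply, hAij, hAij, mul_comm (v j)]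
      simp [eq_comm]
    rw [hT, hA, smul_mul_smul_comm, hs, one_smul, sub_mul, mul_sub, mul_sub, smul_mul_smul_comm, h2]
    rw [smul_smul, one_mul, mul_one, one_mul]
    have : c⁻¹ * c⁻¹ * (2 * c) = 2 * c⁻¹ := by field_simp
    rw [this, mul_smul, two_smul]
    abel
  · ext i
    rw [Matrix.ofLp_toEuclideanCLM]
    simp only [Matrix.mulVec, dotProduct]
    rw [Finset.sum_eq_single 0 (fun j _ hj => by simp [hj]) (by simp), hAij]
    have : v 0 = -s * c := by
      simp only [hv, hc, if_true]
      linear_combination (-x 0) * hs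
    rw [this]
    simp only [PiLp.single_apply, if_true, mul_one, hv]
    field_simp
    linear_combination (x i - s * if i = 0 then 1 else 0) * hs
  · change c * A i j = _
    rw [hAij]
    field_simp
    ring

variable [NeZero p] [NeZero q]

/-- The point `(e_0, e_0)` of the cone. -/
noncomputable def basePoint (p q : ℕ) [NeZero p] [NeZero q] : cone p q :=
  ⟨(EuclideanSpace.single 0 1, EuclideanSpace.single 0 1), mem_cone_iff.2 ⟨⟨by simp, by simp⟩, by simp⟩⟩

/-- The common denominator of the sections below. -/
noncomputable def sectionDenom (p q : ℕ) [NeZero p] [NeZero q] (s t : ℝ) : Poly p q :=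
  (1 - C (s : ℂ) * X (xVar p q 0)) * (1 - C (t : ℂ) * X (yVar p q 0))

/-- The numerators of the sections below. -/
noncomputable def sectionNumer (p q : ℕ) [NeZero p] [NeZero q] (s t : ℝ) :
    (Fin p × Fin p) ⊕ (Fin q × Fin q) → Poly p q :=
  Sum.elim
    (fun k => (1 - C (t : ℂ) * X (yVar p q 0)) * (C (s : ℂ) *
      ((1 - C (s : ℂ) * X (xVar p q 0)) * (if k.1 = k.2 then 1 else 0) -
        (X (xVar p q k.1) - C (s : ℂ) * (if k.1 = 0 then 1 else 0)) *
        (X (xVar p q k.2) - C (s : ℂ) * (if k.2 = 0 then 1 else 0)))))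
    (fun k => (1 - C (s : ℂ) * X (xVar p q 0)) * (C (t : ℂ) *
      ((1 - C (t : ℂ) * X (yVar p q 0)) * (if k.1 = k.2 then 1 else 0) -
        (X (yVar p q k.1) - C (t : ℂ) * (if k.1 = 0 then 1 else 0)) *
        (X (yVar p q k.2) - C (t : ℂ) * (if k.2 = 0 then 1 else 0)))))

theorem dilate_norm_smul {w : cone p q} {r : ℝ} (hr : 0 < r) {h : CompactGroup p q}
    (hw : CompactGroup.act p q h (basePoint p q).1 = r⁻¹ • w.1) :
    w = dilate r hr.ne' (CompactGroup.incl p q h • basePoint p q) :=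
  Subtype.ext (by
    change w.1 = r • CompactGroup.act p q h (basePoint p q).1
    rw [hw, smul_inv_smul₀ hr.ne'])

theorem exists_section {s t : ℝ} (hs : s * s = 1) (ht : t * t = 1) (w : cone p q)
    (hw : eval (unitCoord w.1) (sectionDenom p q s t) ≠ 0) :
    ∃ h : CompactGroup p q, CompactGroup.act p q h (basePoint p q).1 = ‖w.1.1‖⁻¹ • w.1 ∧
      ∀ k, eval (unitCoord w.1) (sectionDenom p q s t) * (CompactGroup.entry h k : ℂ) =
        eval (unitCoord w.1) (sectionNumer p q s t k) := by
  have hr : ‖w.1.1‖ ≠ 0 := norm_ne_zero_iff.2 (mem_neighborhood w.2).1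
  have hn := norm_fst_eq_norm_snd w.2
  set x : EuclideanSpace ℝ (Fin p) := ‖w.1.1‖⁻¹ • w.1.1 with hx
  set y : EuclideanSpace ℝ (Fin q) := ‖w.1.1‖⁻¹ • w.1.2 with hy
  have hx1 : ‖x‖ = 1 := by rw [hx, norm_smul, norm_inv, norm_norm, inv_mul_cancel₀ hr]
  have hy1 : ‖y‖ = 1 := by rw [hy, norm_smul, norm_inv, norm_norm, ← hn, inv_mul_cancel₀ hr]
  have hux (i) : unitCoord w.1 (xVar p q i) = (x i : ℂ) := by
    rw [xVar, unitCoord_inl, hx, PiLp.smul_apply, smul_eq_mul, div_eq_inv_mul]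
  have huy (i) : unitCoord w.1 (yVar p q i) = (y i : ℂ) := by
    rw [yVar, unitCoord_inr, hy, PiLp.smul_apply, smul_eq_mul, div_eq_inv_mul]
  have hD : eval (unitCoord w.1) (sectionDenom p q s t) =
      (((1 - s * x 0) * (1 - t * y 0) : ℝ) : ℂ) := by
    simp [sectionDenom, hux, huy]
  rw [hD, Complex.ofReal_ne_zero, mul_ne_zero_iff] at hw
  obtain ⟨A, hA, hA'⟩ := exists_orthogonal_apply_single hx1 hs hw.1
  obtain ⟨B, hB, hB'⟩ := exists_orthogonal_apply_single hy1 ht hw.2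
  refine ⟨CompactGroup.mk A B, Prod.ext hA hB, fun k => ?_⟩
  rw [hD]
  rcases k with ⟨i, j⟩ | ⟨i, j⟩
  · change (((1 - s * x 0) * (1 - t * y 0) : ℝ) : ℂ) * ((A.1 i j : ℝ) : ℂ) = _
    rw [← Complex.ofReal_mul, mul_right_comm, hA']
    simp only [sectionNumer, Sum.elim_inl]
    split_ifs <;> simp [hux, huy] <;> ring
  · change (((1 - s * x 0) * (1 - t * y 0) : ℝ) : ℂ) * ((B.1 i j : ℝ) : ℂ) = _
    rw [← Complex.ofReal_mul, mul_assoc, hB']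
    simp only [sectionNumer, Sum.elim_inr]
    split_ifs <;> simp [hux, huy]

/-- Transitivity of `K` on the product of spheres: in each factor at least one of the signs `±1`
gives a nonzero denominator. -/
theorem exists_act_basePoint (w : cone p q) :
    ∃ h : CompactGroup p q, CompactGroup.act p q h (basePoint p q).1 = ‖w.1.1‖⁻¹ • w.1 := by
  have hz (z : ℂ) : ∃ s : ℝ, s * s = 1 ∧ 1 - (s : ℂ) * z ≠ 0 := by
    by_cases h : z = 1
    · exact ⟨-1, by norm_num, by rw [h]; norm_num⟩
    · exact ⟨1, by norm_num, by simpa [sub_eq_zero] using Ne.symm h⟩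
  obtain ⟨s, hs, hs'⟩ := hz (unitCoord w.1 (xVar p q 0))
  obtain ⟨t, ht, ht'⟩ := hz (unitCoord w.1 (yVar p q 0))
  obtain ⟨h, hh, -⟩ := exists_section hs ht w (by simp [sectionDenom, hs', ht'])
  exact ⟨h, hh⟩

/-- A function on the cone whose pullback to `O(p) × O(q)` is polynomial is polynomial. -/
theorem exists_eval_eq {F : cone p q → ℂ} {Φ : MvPolynomial ((Fin p × Fin p) ⊕ (Fin q × Fin q)) ℂ}
    (hF : ∀ (w : cone p q) (h : CompactGroup p q),
      CompactGroup.act p q h (basePoint p q).1 = ‖w.1.1‖⁻¹ • w.1 →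
      F w = eval (fun k => (CompactGroup.entry h k : ℂ)) Φ) :
    ∃ P : Poly p q, ∀ w : cone p q, F w = eval (unitCoord w.1) P := by
  have key {s t : ℝ} (hs : s * s = 1) (ht : t * t = 1) :
      sectionDenom p q s t ∈ (denominators F).radical := by
    obtain ⟨n, P, hP⟩ := exists_pow_mul_eval (sectionDenom p q s t) (sectionNumer p q s t) Φ
    -- The extra power of the denominator makes both sides vanish where no section is available.
    refine ⟨n + 1, sectionDenom p q s t * P, fun w => ?_⟩
    by_cases hw : eval (unitCoord w.1) (sectionDenom p q s t) = 0
    · rw [map_pow, map_mul, hw, zero_mul, pow_succ, mul_zero, zero_mul]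
    · obtain ⟨h, hh, hk⟩ := exists_section hs ht w hw
      rw [map_pow, map_mul, ← hP _ _ hk, hF w h hh, pow_succ']
      ring
  have h1 : (1 : ℝ) * 1 = 1 := one_mul 1
  have h2 : (-1 : ℝ) * -1 = 1 := by norm_num
  -- The denominators for the four choices of signs add up to `4`, so they generate the unit ideal.
  -- Hence `1` itself is a denominator, and the local rational expressions come from one polynomial.
  have h4 : (1 : Poly p q) = C (4⁻¹ : ℂ) * (sectionDenom p q 1 1 + sectionDenom p q 1 (-1) +
      sectionDenom p q (-1) 1 + sectionDenom p q (-1) (-1)) := by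
    have : (C (4⁻¹ : ℂ) * 4 : Poly p q) = 1 := by
      rw [← map_ofNat C 4, ← C_mul]; norm_num
    rw [← this]
    simp only [sectionDenom, Complex.ofReal_one, Complex.ofReal_neg, map_one, map_neg]
    ring
  have h5 : (1 : Poly p q) ∈ (denominators F).radical := by
    rw [h4]
    exact Ideal.mul_mem_left _ _ (add_mem (add_mem (add_mem (key h1 h1) (key h1 h2)) (key h2 h1))
      (key h2 h2))
  obtain ⟨n, P, hP⟩ := h5
  exact ⟨P, fun w => by simpa using hP w⟩

end LightCone

namespace LightCone

open MeasureTheory Filter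

variable {p q : ℕ}

open MvPolynomial

/-! ### Approximation by polynomial functions -/

namespace CompactGroup

/-- Integrals of right translates of polynomial functions of the entries are polynomial. -/
theorem exists_integral_eq_eval (Ψ : MvPolynomial ((Fin p × Fin p) ⊕ (Fin q × Fin q)) ℂ) :
    ∀ {f : CompactGroup p q → ℂ}, Continuous f →
    ∃ Φ : MvPolynomial ((Fin p × Fin p) ⊕ (Fin q × Fin q)) ℂ, ∀ h : CompactGroup p q,
      ∫ k, eval (fun t => (entry (h * k) t : ℂ)) Ψ * f k ∂haar p q =
        eval (fun t => (entry h t : ℂ)) Φ := by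
  have hc {Ψ : MvPolynomial ((Fin p × Fin p) ⊕ (Fin q × Fin q)) ℂ} {f : CompactGroup p q → ℂ}
      (hf : Continuous f) (h : CompactGroup p q) :
      Integrable (fun k => eval (fun t => (entry (h * k) t : ℂ)) Ψ * f k) (haar p q) := by
    refine (Continuous.mul ?_ hf).integrable_of_hasCompactSupport
      (HasCompactSupport.of_compactSpace _)
    refine (MvPolynomial.continuous_eval Ψ).comp (continuous_pi fun t => ?_)
    exact Complex.continuous_ofReal.comp ((continuous_entry t).comp (continuous_const_mul h))
  induction Ψ using MvPolynomial.induction_on with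
  | C r => exact fun {f} _ => ⟨C (r * ∫ k, f k ∂haar p q), fun h => by simp [integral_const_mul]⟩
  | add Ψ₁ Ψ₂ h₁ h₂ =>
    intro f hf
    obtain ⟨Φ₁, hΦ₁⟩ := h₁ hf
    obtain ⟨Φ₂, hΦ₂⟩ := h₂ hf
    refine ⟨Φ₁ + Φ₂, fun h => ?_⟩
    simp only [map_add, add_mul]
    rw [integral_add (hc hf h) (hc hf h), hΦ₁, hΦ₂]
  | mul_X Ψ t hΨ =>
    intro f hf
    -- An entry of `h * k` is a sum of products of an entry of `h` and an entry of `k`. The latter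
    -- is absorbed into `f`, which is why `f` is quantified inside the induction.
    have he (s) : Continuous fun k : CompactGroup p q => (entry k s : ℂ) * f k :=
      (Complex.continuous_ofReal.comp (continuous_entry s)).mul hf
    rcases t with ⟨i, j⟩ | ⟨i, j⟩
    · choose Φ hΦ using fun l => hΨ (he (Sum.inl (l, j)))
      refine ⟨∑ l, X (Sum.inl (i, l)) * Φ l, fun h => ?_⟩
      have hm (k : CompactGroup p q) : entry (h * k) (Sum.inl (i, j)) =
        ∑ l, entry h (Sum.inl (i, l)) * entry k (Sum.inl (l, j)) := rfl
      simp only [map_mul, map_sum, eval_X, ← hΦ, ← integral_const_mul]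
      rw [← integral_finsetSum _ fun l _ => (hc (he _) h).const_mul _]
      refine integral_congr_ae (Eventually.of_forall fun k => ?_)
      simp only [hm, Complex.ofReal_sum, Complex.ofReal_mul, Finset.sum_mul, Finset.mul_sum]
      exact Finset.sum_congr rfl fun l _ => by ring
    · choose Φ hΦ using fun l => hΨ (he (Sum.inr (l, j)))
      refine ⟨∑ l, X (Sum.inr (i, l)) * Φ l, fun h => ?_⟩
      have hm (k : CompactGroup p q) : entry (h * k) (Sum.inr (i, j)) =
        ∑ l, entry h (Sum.inr (i, l)) * entry k (Sum.inr (l, j)) := rfl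
      simp only [map_mul, map_sum, eval_X, ← hΦ, ← integral_const_mul]
      rw [← integral_finsetSum _ fun l _ => (hc (he _) h).const_mul _]
      refine integral_congr_ae (Eventually.of_forall fun k => ?_)
      simp only [hm, Complex.ofReal_sum, Complex.ofReal_mul, Finset.sum_mul, Finset.mul_sum]
      exact Finset.sum_congr rfl fun l _ => by ring

/-- A polynomial function of the entries with a strict positive maximum at the identity. -/
theorem exists_peak (p q : ℕ) :
    ∃ (c : CompactGroup p q → ℝ) (Ψ : MvPolynomial ((Fin p × Fin p) ⊕ (Fin q × Fin q)) ℂ),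
      Continuous c ∧ (∀ k, (c k : ℂ) = eval (fun t => (entry k t : ℂ)) Ψ) ∧
      (∀ k, k ≠ 1 → c k < c 1) ∧ (∀ k, 0 ≤ c k) ∧ 0 < c 1 := by
  set d : CompactGroup p q → ℝ := fun k => ∑ t, (entry k t - entry 1 t) ^ 2 with hd
  have hdc : Continuous d :=
    continuous_finsetSum _ fun t _ => ((continuous_entry t).sub continuous_const).pow 2
  have hd1 : d 1 = 0 := by simp [hd]
  obtain ⟨B, hB⟩ := (isCompact_range hdc).bddAbove
  have hB (k) : d k ≤ B := hB (mem_range_self k)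
  -- `B` bounds the squared distance `d` of the entries from those of the identity, so this function
  -- is at least `1` everywhere.
  refine ⟨fun k => B + 1 - d k,
    C ((B + 1 : ℝ) : ℂ) - ∑ t, (X t - C ((entry (1 : CompactGroup p q) t : ℝ) : ℂ)) ^ 2,
    continuous_const.sub hdc, fun k => ?_, fun k hk => ?_, fun k => ?_, ?_⟩
  · simp [hd]
  · have : 0 < d k := by
      refine (Finset.sum_nonneg fun t _ => sq_nonneg _).lt_of_ne fun h => hk ?_
      refine entry_injective (funext fun t => ?_)
      have := (Finset.sum_eq_zero_iff_of_nonneg fun t _ => sq_nonneg _).1 h.symm t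
        (Finset.mem_univ t)
      exact sub_eq_zero.1 (pow_eq_zero_iff two_ne_zero |>.1 this)
    dsimp only
    rw [hd1]
    linarith
  · linarith [hB k]
  · have := hB 1
    dsimp only
    rw [hd1] at this ⊢
    linarith

end CompactGroup

open CompactGroup

theorem Smooth.apply_dilate {a : ℂ} {f : Smooth p q} (hf : f ∈ homogeneous p q a) {r : ℝ}
    (hr : 0 < r) (g : indefiniteOrthogonalGroup p q) (w : cone p q) :
    f (g • dilate r hr.ne' w) = Complex.exp (a * Real.log r) * f (g • w) := by
  rw [smul_dilate, hf r hr, exp_mul_log hr]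

theorem continuous_incl_inv_smul (f : Smooth p q) (w : cone p q) :
    Continuous fun k : CompactGroup p q => f ((incl p q k)⁻¹ • w) := by
  have h := (CompactGroup.jetContinuous f).continuous
  exact (continuous_eval w).comp h

variable [NeZero p] [NeZero q]

/-- Write `w` as `|x| h` applied to the base point. Translating the Haar integral by `h` moves all
dependence on `h` into the factor `Ψ(h k)`, so the integral is `|x|^a` times a polynomial in the
entries of `h`, and `exists_eval_eq` descends it to the cone. -/
theorem exists_polyMap_apply_eq_integral {a : ℂ} {f : Smooth p q} (hf : f ∈ homogeneous p q a)
    (Ψ : MvPolynomial ((Fin p × Fin p) ⊕ (Fin q × Fin q)) ℂ) :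
    ∃ P : Poly p q, ∀ w, polyMap p q a P w =
      ∫ k, eval (fun t => (entry k t : ℂ)) Ψ * rho p q (incl p q k) f w ∂haar p q := by
  obtain ⟨Φ, hΦ⟩ := exists_integral_eq_eval Ψ (continuous_incl_inv_smul f (basePoint p q))
  set F : cone p q → ℂ := fun w => (Complex.exp (a * Real.log ‖w.1.1‖))⁻¹ *
    ∫ k, eval (fun t => (entry k t : ℂ)) Ψ * rho p q (incl p q k) f w ∂haar p q with hF
  suffices h : ∀ (w : cone p q) (h : CompactGroup p q),
      act p q h (basePoint p q).1 = ‖w.1.1‖⁻¹ • w.1 → F w = eval (fun k => (entry h k : ℂ)) Φ by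
    obtain ⟨P, hP⟩ := exists_eval_eq h
    refine ⟨P, fun w => ?_⟩
    rw [polyMap_apply, polyFun, ← hP, hF, mul_inv_cancel_left₀ (Complex.exp_ne_zero _)]
  intro w h hw
  have hr : 0 < ‖w.1.1‖ := norm_pos_iff.2 (mem_neighborhood w.2).1
  have hw' := dilate_norm_smul hr hw
  rw [← hΦ, hF]
  dsimp only
  rw [inv_mul_eq_iff_eq_mul₀ (Complex.exp_ne_zero _), ← integral_const_mul,
    ← integral_mul_left_eq_self _ h]
  refine integral_congr_ae (Eventually.of_forall fun k => ?_)
  dsimp only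
  have : rho p q (incl p q (h * k)) f w =
      Complex.exp (a * Real.log ‖w.1.1‖) * f ((incl p q k)⁻¹ • basePoint p q) := by
    rw [rho_apply]
    conv_lhs => rw [hw']
    rw [Smooth.apply_dilate hf hr, map_mul, mul_inv_rev, mul_smul, inv_smul_smul]
  rw [this]
  ring

/-- Homogeneous functions are limits of polynomial functions, which belong to every closed
invariant subspace that contains the given function. -/
theorem exists_tendsto_polyMap {a : ℂ} {f : Smooth p q} (hf : f ∈ homogeneous p q a) :
    ∃ P : ℕ → Poly p q, Tendsto (fun n => polyMap p q a (P n)) atTop (𝓝 f) ∧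
      ∀ W, IsClosedInvariant W → f ∈ W → ∀ n, polyMap p q a (P n) ∈ W := by
  obtain ⟨c, Ψ, hc, hΨ, hlt, h₀, hpos⟩ := exists_peak p q
  choose P hP using fun n : ℕ => exists_polyMap_apply_eq_integral hf (Ψ ^ n)
  simp only [map_pow, ← hΨ] at hP
  have hG := CompactGroup.jetContinuous f
  refine ⟨fun n => (((∫ k, c k ^ n ∂haar p q)⁻¹ : ℝ) : ℂ) • P n, ?_, fun W hW hfW n => ?_⟩
  · have h := hG.tendsto_peak (μ := haar p q) hc hlt h₀ hpos hP
    rw [map_one, map_one] at h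
    simp only [map_smul]
    exact h
  · rw [map_smul]
    refine W.smul_mem _ ?_
    have hc' : Continuous fun k => (c k : ℂ) ^ n := (Complex.continuous_ofReal.comp hc).pow n
    exact (hG.smul hc').integral_mem (μ := haar p q) (hP n) hW.isClosed
      fun k => W.smul_mem _ (hW.rho_mem _ f hfW)

end LightCone

namespace LightCone

open MeasureTheory Filter

variable {p q : ℕ}

open MvPolynomial CompactGroup

/-! ### Irreducibility -/

/-- The negative of a point of the cone. -/
noncomputable def negate (w : cone p q) : cone p q := dilate (-1) (neg_ne_zero.2 one_ne_zero) w

theorem polyFun_ne_zero_iff {a : ℂ} {P : Poly p q} {w : Ambient p q} :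
    polyFun a P w ≠ 0 ↔ eval (unitCoord w) P ≠ 0 := by
  rw [polyFun, mul_ne_zero_iff]
  exact and_iff_right (Complex.exp_ne_zero _)

theorem polyMap_mem_parity_iff {a : ℂ} {P : Poly p q} {ε : ℤˣ} :
    polyMap p q a P ∈ parity p q ε ↔
      ∀ w ∈ cone p q, eval (-unitCoord w) P = ((ε : ℤ) : ℂ) * eval (unitCoord w) P := by
  have h (w : cone p q) : polyMap p q a P (negate w) =
      Complex.exp (a * Real.log ‖w.1.1‖) * eval (-unitCoord w.1) P := by
    change polyFun a P ((-1 : ℝ) • w.1) = _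
    rw [polyFun, funext (unitCoord_neg w.1), Prod.smul_fst, norm_smul, norm_neg, norm_one, one_mul]
    rfl
  constructor
  · intro hP w hw
    have := (h ⟨w, hw⟩).symm.trans (hP ⟨w, hw⟩)
    rw [polyMap_apply, polyFun, mul_left_comm] at this
    exact mul_left_cancel₀ (Complex.exp_ne_zero _) this
  · intro hP w
    refine (h w).trans ?_
    rw [hP w.1 w.2, polyMap_apply, polyFun, mul_left_comm]

/-- The polynomial with conjugate coefficients. -/
noncomputable def conjPoly (P : Poly p q) : Poly p q := map (starRingEnd ℂ) P

theorem star_unitCoord (w : Ambient p q) : (fun k => starRingEnd ℂ (unitCoord w k)) = unitCoord w :=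
  funext fun _ => Complex.conj_ofReal _

theorem eval_conjPoly {u : Fin p ⊕ Fin q → ℂ} (hu : (fun k => starRingEnd ℂ (u k)) = u)
    (P : Poly p q) : eval u (conjPoly P) = starRingEnd ℂ (eval u P) := by
  conv_lhs => rw [← hu]
  exact (eval₂_comp_left (starRingEnd ℂ) (RingHom.id ℂ) u P ▸ by
    rw [conjPoly, eval_map]; rfl)

theorem star_neg_unitCoord (w : Ambient p q) :
    (fun k => starRingEnd ℂ ((-unitCoord w) k)) = -unitCoord w :=
  funext fun k => by
    rw [Pi.neg_apply, map_neg]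
    exact congrArg _ (Complex.conj_ofReal _)

theorem contDiffOn_eval_unitCoord (P : Poly p q) :
    ContDiffOn ℝ ∞ (fun w : Ambient p q => eval (unitCoord w) P) (neighborhood p q) :=
  (contDiffOn_polyFun 0 P).congr fun w _ => by
    rw [polyFun, zero_mul, Complex.exp_zero, one_mul]

theorem isClosed_homogeneous (a : ℂ) : IsClosed (homogeneous p q a : Set (Smooth p q)) := by
  have : (homogeneous p q a : Set (Smooth p q)) = ⋂ (t : ℝ) (ht : 0 < t) (w : cone p q),
      {f : Smooth p q | f (dilate t ht.ne' w) = (t : ℂ) ^ a * f w} := by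
    ext f
    simp only [mem_iInter, Set.mem_ofPred_eq]
    rfl
  rw [this]
  exact isClosed_iInter fun t => isClosed_iInter fun ht => isClosed_iInter fun w =>
    isClosed_eq (continuous_eval _) (continuous_const.mul (continuous_eval _))

theorem isClosed_parity (ε : ℤˣ) : IsClosed (parity p q ε : Set (Smooth p q)) := by
  have : (parity p q ε : Set (Smooth p q)) = ⋂ (w : cone p q),
      {f : Smooth p q | f (negate w) = ((ε : ℤ) : ℂ) * f w} := by
    ext f
    simp only [mem_iInter, Set.mem_ofPred_eq]
    rfl
  rw [this]
  exact isClosed_iInter fun w =>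
    isClosed_eq (continuous_eval _) (continuous_const.mul (continuous_eval _))

theorem isClosedInvariant_homogeneousParity (a : ℂ) (ε : ℤˣ) :
    IsClosedInvariant (homogeneousParity p q a ε).toSubmodule where
  isClosed := (isClosed_homogeneous a).inter (isClosed_parity ε)
  rho_mem g _ hf := (homogeneousParity p q a ε).apply_mem_toSubmodule g hf

variable [NeZero p] [NeZero q]

/-- Each translate `R k` of `P` yields `|R k|² Q` in `W`. The average of `|R k|²` over `K` is a
positive constant on the cone, so the average of these functions is a nonzero multiple of `Q`. -/
theorem IsClosedInvariant.polyMap_mem {W : Submodule ℂ (Smooth p q)} (hW : IsClosedInvariant W)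
    {a : ℂ} (ha : ∀ n : ℤ, a ≠ n) {ε : ℤˣ} (hε : W ≤ (homogeneousParity p q a ε).toSubmodule)
    {P : Poly p q} (hP : polyMap p q a P ∈ W) (hP₀ : polyMap p q a P ≠ 0) {Q : Poly p q}
    (hQ : polyMap p q a Q ∈ parity p q ε) : polyMap p q a Q ∈ W := by
  set R : CompactGroup p q → Poly p q := fun k => aeval (subst k⁻¹) P with hR
  have hRW (k) : polyMap p q a (R k) ∈ W := by
    rw [hR, ← rho_incl_polyMap]
    exact hW.rho_mem _ _ hP
  have hReval (k) (w : cone p q) :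
      eval (unitCoord w.1) (R k) = eval (unitCoord (act p q k⁻¹ w.1)) P := by
    have h := polyFun_aeval 0 P (norm_act_fst k⁻¹ w.1) fun l => unitCoord_act k⁻¹ w.1 l
    simpa only [polyFun, zero_mul, Complex.exp_zero, one_mul] using h.symm
  set G : CompactGroup p q → Smooth p q :=
    fun k => polyMap p q a (conjPoly (R k) * Q * R k) with hG
  have hGW (k) : G k ∈ W := by
    -- The multiplier `conj(R k) * Q` is even because both factors have parity `ε` and `ε² = 1`.
    refine hW.even_mul_mem ha (hRW k) fun w hw => ?_
    have h₁ := polyMap_mem_parity_iff.1 (hε (hRW k)).2 w hw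
    have h₂ := polyMap_mem_parity_iff.1 hQ w hw
    rw [map_mul, map_mul, h₂, eval_conjPoly (star_neg_unitCoord w), h₁,
      eval_conjPoly (star_unitCoord w), map_mul, map_intCast]
    have : ((ε : ℤ) : ℂ) * ((ε : ℤ) : ℂ) = 1 := by
      rw [← Int.cast_mul, ← Units.val_mul, Int.units_mul_self]; simp
    linear_combination (starRingEnd ℂ (eval (unitCoord w) (R k)) * eval (unitCoord w) Q) * this
  set N : Ambient p q → ℂ :=
    fun w => starRingEnd ℂ (eval (unitCoord w) P) * eval (unitCoord w) P with hN
  have hNc : ContDiffOn ℝ ∞ N (neighborhood p q) :=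
    (Complex.conjCLE.contDiff.comp_contDiffOn (contDiffOn_eval_unitCoord P)).mul
      (contDiffOn_eval_unitCoord P)
  have hGN (k) (w : cone p q) : G k w = N (act p q k⁻¹ w.1) * polyMap p q a Q w := by
    change polyFun a _ w.1 = _ * polyFun a Q w.1
    rw [mul_right_comm, polyFun_mul, map_mul, eval_conjPoly (star_unitCoord w.1), hReval]
  have hNa : ContDiffOn ℝ ∞ (fun z : (Ambient p q →L[ℝ] Ambient p q) × Ambient p q => N (z.1 z.2))
      {z | z.1 z.2 ∈ neighborhood p q} :=
    hNc.comp (contDiff_fst.clm_apply contDiff_snd).contDiffOn fun _ hz => hz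
  have hmem (k : CompactGroup p q) (w : cone p q) : act p q k w.1 ∈ neighborhood p q :=
    mem_neighborhood (incl p q k • w).2
  have hGc : JetContinuous G := by
    refine jetContinuous_of_contDiffOn (ι := fun k : CompactGroup p q => act p q k⁻¹)
      (F := fun z => N (z.1 z.2) * polyFun a Q z.2)
      (O := {z | z.1 z.2 ∈ neighborhood p q} ∩ {z | z.2 ∈ neighborhood p q})
      (continuous_act.comp continuous_inv)
      (isOpen_apply_mem_neighborhood.inter (isOpen_neighborhood.preimage continuous_snd))
      ((hNa.mono inter_subset_left).mul ((contDiffOn_polyFun a Q).comp contDiff_snd.contDiffOn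
        fun _ hz => hz.2)) (fun k w => ⟨hmem k⁻¹ w, mem_neighborhood w.2⟩) hGN
  set ν : CompactGroup p q → ℝ := fun k => Complex.normSq
    (eval (unitCoord (act p q k⁻¹ (basePoint p q).1)) P) with hν
  have hνN (k) : N (act p q k⁻¹ (basePoint p q).1) = (ν k : ℂ) := by
    rw [hN, hν]
    exact (Complex.normSq_eq_conj_mul_self).symm
  have hνc : Continuous ν := by
    refine Complex.continuous_normSq.comp ?_
    refine (contDiffOn_eval_unitCoord P).continuousOn.comp_continuous
      (f := fun k => act p q k⁻¹ (basePoint p q).1) ?_ fun k => hmem k⁻¹ _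
    exact (continuous_act.comp continuous_inv).clm_apply continuous_const
  have hunit (w : cone p q) (k h : CompactGroup p q)
      (hw : act p q h (basePoint p q).1 = ‖w.1.1‖⁻¹ • w.1) :
      unitCoord (act p q k w.1) = unitCoord (act p q (k * h) (basePoint p q).1) := by
    have hr : 0 < ‖w.1.1‖ := norm_pos_iff.2 (mem_neighborhood w.2).1
    rw [map_mul, mul_apply_eq_comp, hw, map_smul, unitCoord_smul (inv_pos.2 hr)]
  -- Moving `w` to the base point by `h` is absorbed by the left invariance of Haar measure, so the
  -- mean of `|P|²` over the translates does not depend on `w`.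
  have hint (w : cone p q) : ((∫ k, ν k ∂haar p q : ℝ) : ℂ) * polyMap p q a Q w =
      ∫ k, G k w ∂haar p q := by
    obtain ⟨h, hh⟩ := exists_act_basePoint w
    simp only [hGN]
    rw [integral_mul_const, ← integral_mul_left_eq_self (fun k => N (act p q k⁻¹ w.1)) h,
      ← integral_complex_ofReal]
    congr 2
    funext k
    rw [← hνN, hN]
    dsimp only
    rw [hunit w _ h hh, mul_inv_rev, inv_mul_cancel_right]
  have hpos : 0 < ∫ k, ν k ∂haar p q := by
    obtain ⟨w, hw⟩ : ∃ w, polyMap p q a P w ≠ 0 := by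
      by_contra! hw
      exact hP₀ (Smooth.ext hw)
    obtain ⟨h, hh⟩ := exists_act_basePoint w
    refine hνc.integral_pos_of_hasCompactSupport_nonneg_nonzero
      (HasCompactSupport.of_compactSpace _) (fun k => Complex.normSq_nonneg _) (x := h⁻¹) ?_
    have h₁ := polyFun_ne_zero_iff.1 hw
    have h₂ := hunit w 1 h hh
    rw [map_one, one_mul] at h₂
    rw [hν]
    dsimp only
    rw [inv_inv, ← h₂]
    exact (map_ne_zero Complex.normSq).2 h₁
  have h := hGc.integral_mem (μ := haar p q)
    (g := ((∫ k, ν k ∂haar p q : ℝ) : ℂ) • polyMap p q a Q) hint hW.isClosed hGW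
  exact (W.smul_mem_iff (Complex.ofReal_ne_zero.2 hpos.ne')).1 h

/-- A closed invariant subspace of `S^{a±}(X⁰)` is zero or everything. -/
theorem IsClosedInvariant.eq_bot_or_eq {W : Submodule ℂ (Smooth p q)} (hW : IsClosedInvariant W)
    {a : ℂ} (ha : ∀ n : ℤ, a ≠ n) {ε : ℤˣ} (hε : W ≤ (homogeneousParity p q a ε).toSubmodule) :
    W = ⊥ ∨ W = (homogeneousParity p q a ε).toSubmodule := by
  refine or_iff_not_imp_left.2 fun hW₀ => le_antisymm hε fun g hg => ?_
  obtain ⟨P, hP, hP₀⟩ : ∃ P, polyMap p q a P ∈ W ∧ polyMap p q a P ≠ 0 := by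
    obtain ⟨f, hf, hf₀⟩ := W.ne_bot_iff.1 hW₀
    -- If all approximants of `f` were zero, then so would be `f`, since evaluations are continuous.
    obtain ⟨P, hlim, hP⟩ := exists_tendsto_polyMap (hε hf).1
    by_contra! h
    refine hf₀ (Smooth.ext fun w => ?_)
    have h₁ := ((continuous_eval w).tendsto f).comp hlim
    have h₂ : (fun n => polyMap p q a (P n) w) = fun _ => 0 :=
      funext fun n => by rw [h _ (hP W hW hf n)]; rfl
    exact tendsto_nhds_unique h₁ (by
      change Tendsto (fun n => polyMap p q a (P n) w) _ _
      rw [h₂]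
      exact tendsto_const_nhds)
  obtain ⟨Q, hlim, hQ⟩ := exists_tendsto_polyMap hg.1
  -- The approximants of `g` lie in the closed invariant space `S^{a±}`, so they have the parity
  -- that `polyMap_mem` requires.
  exact hW.isClosed.mem_of_tendsto hlim (Eventually.of_forall fun n => hW.polyMap_mem ha hε hP hP₀
    (hQ _ (isClosedInvariant_homogeneousParity a ε) hg n).2)

theorem nontrivial_homogeneousParity (a : ℂ) (ε : ℤˣ) :
    Nontrivial (homogeneousParity p q a ε).toSubmodule := by
  obtain ⟨P, hP, hP₀⟩ : ∃ P : Poly p q, polyMap p q a P ∈ parity p q ε ∧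
      eval (unitCoord (basePoint p q).1) P ≠ 0 := by
    rcases Int.units_eq_one_or ε with rfl | rfl
    · exact ⟨1, polyMap_mem_parity_iff.2 fun w _ => by simp, by simp⟩
    · refine ⟨X (xVar p q 0), polyMap_mem_parity_iff.2 fun w _ => by simp, ?_⟩
      simp [xVar, unitCoord_inl, basePoint]
  refine ⟨⟨⟨polyMap p q a P, polyMap_mem_homogeneous a P, hP⟩, 0, fun h => ?_⟩⟩
  have h₁ : polyMap p q a P = 0 := congrArg Subtype.val h
  refine polyFun_ne_zero_iff.2 hP₀ ((polyMap_apply a P (basePoint p q)).symm.trans ?_)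
  rw [h₁]
  rfl

theorem isTopologicallyIrreducible_homogeneousParity {a : ℂ} (ha : ∀ n : ℤ, a ≠ n) (ε : ℤˣ) :
    IsTopologicallyIrreducible (homogeneousParity p q a ε).toRepresentation := by
  refine ⟨nontrivial_homogeneousParity a ε, fun W hWc => ?_⟩
  set V := (homogeneousParity p q a ε).toSubmodule with hV
  have hinj : Function.Injective V.subtype := V.subtype_injective
  have hW : IsClosedInvariant (W.toSubmodule.map V.subtype) :=
    { isClosed := by
        rw [Submodule.map_coe]
        -- A subspace closed in `S^{a±}` is closed in the whole function space because `S^{a±}` is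
        -- closed there.
        exact (isClosedInvariant_homogeneousParity a ε).isClosed.isClosedEmbedding_subtypeVal.isClosedMap
          _ hWc
      rho_mem := by
        rintro g _ ⟨f, hf, rfl⟩
        exact ⟨_, W.apply_mem_toSubmodule g hf, rfl⟩ }
  rcases hW.eq_bot_or_eq ha (Submodule.map_subtype_le _ _) with h | h
  · exact Or.inl (Submodule.map_injective_of_injective hinj (by rw [h, Submodule.map_bot]))
  · refine Or.inr (Submodule.map_injective_of_injective hinj ?_)
    rw [h, Submodule.map_subtype_top]

end LightCone

theorem proposition2p4 (p q : ℕ) (hp : 1 ≤ p) (hq : 1 ≤ q) (a : ℂ) (ha : ∀ n : ℤ, a ≠ n) :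
    LightCone.IsTopologicallyIrreducible
        (LightCone.homogeneousParity p q a 1).toRepresentation ∧
      LightCone.IsTopologicallyIrreducible
        (LightCone.homogeneousParity p q a (-1)).toRepresentation := by
  have : NeZero p := ⟨Nat.one_le_iff_ne_zero.1 hp⟩
  have : NeZero q := ⟨Nat.one_le_iff_ne_zero.1 hq⟩
  exact ⟨LightCone.isTopologicallyIrreducible_homogeneousParity ha 1,
    LightCone.isTopologicallyIrreducible_homogeneousParity ha (-1)⟩
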